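/- Theorem 5.1. There is an absolute constant $C_0>0$ such that the following holds for every $C\ge C_0$. Let $0<\varepsilon<1$ and let $G=(V,E)$ be a finite simple unweighted graph on $n$ vertices with degrees $d_i$, neighbourhoods $\Gamma(i)$ and average degree $\Delta=\frac1n\sum_{i} d_i>0$. Put $$\alpha_\varepsilon=\frac{\varepsilon^4}{C\log n},\qquad h_i=\min\Bigl\{1,\frac{\max\{d_i,\varepsilon\Delta\}}{\Delta^2\alpha_\varepsilon}\Bigr\},\qquad q=\frac{16\log n}{\varepsilon^2\Delta},$$ and let $p_i\in[h_i,2h_i]$ with $q\le p_i\le 1$ for all $i\in V$. Sample $(S,S')$ as follows: $S'$ contains each $i\in V$ independently with probability $p_i$; then $S\subseteq S'$ contains each $i\in S'$ independently with probability $q/p_i$. Let $H$ be the subgraph of $G$ induced on $S'$, with edge weights $w_{ij}=\frac{1}{p_ip_j\Delta^2}$. For a graph with vertex set $U$, neighbourhoods $\Gamma_U(i)$ and edge weights $w_{ij}$, numbers $\gamma_i>0$ $(i\in U)$ and a partition $(A,S\setminus A)$ of $S\subseteq U$, put $d_i=\sum_{j\in\Gamma_U(i)}w_{ij}$ and $\rho_i=\sum_{j\in\Gamma_U(i)\cap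 A}w_{ij}/\gamma_j$, and let $LP^{\gamma}_{A,S\setminus A}$ of this graph be the optimal value of the linear program in the variables $x_i,s_i,t_i$ $(i\in U)$ $$\max\ \sum_{i\in U}\bigl[x_i(d_i-\rho_i)-(s_i+t_i)\bigr]\quad\text{s.t.}\quad \rho_i-t_i\le\sum_{j\in\Gamma_U(i)}w_{ij}x_j\le\rho_i+s_i,\quad 0\le x_i\le1,\quad s_i,t_i\ge0\quad(i\in U).$$ Let $\gamma_i=q$ for $i \in V$, and $\alpha_i=q/p_i$ for $i\in S'$; in $G$ all edges have weight $1$. Then, with probability at least $1-\frac1{n^2}$ over $(S,S')$, $$\max_{A\subseteq S}LP^{\gamma}_{A,S\setminus A}(G)\ \ge\ \Delta^2\cdot\max_{A\subseteq S}LP^{\alpha}_{A,S\setminus A}(H)\ -\ \varepsilon n\Delta .$$ -/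

import Mathlib

namespace VertexSample

open Finset

section Graph

variable {V : Type*} [Fintype V] [DecidableEq V]

/-- The average degree `Δ = (∑ v, d_v) / n` of a graph on `n` vertices. -/
noncomputable def avgDegree (G : SimpleGraph V) [DecidableRel G.Adj] : ℝ :=
  (∑ v, (G.degree v : ℝ)) / (Fintype.card V : ℝ)

/-- The parameter `α_ε = ε⁴ / (C log n)`. -/
noncomputable def alphaParam (C ε : ℝ) (n : ℕ) : ℝ :=
  ε ^ 4 / (C * Real.log n)

/-- The importance score `h_v = min {1, max {d_v, ε Δ} / (Δ² α_ε)}`. -/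
noncomputable def importanceScore (G : SimpleGraph V) [DecidableRel G.Adj] (C ε : ℝ) (v : V) : ℝ :=
  min 1 (max (G.degree v : ℝ) (ε * avgDegree G) /
    (avgDegree G ^ 2 * alphaParam C ε (Fintype.card V)))

/-- The uniform seed probability `q = 16 log n / (ε² Δ)`. -/
noncomputable def seedProb (G : SimpleGraph V) [DecidableRel G.Adj] (ε : ℝ) : ℝ :=
  16 * Real.log (Fintype.card V) / (ε ^ 2 * avgDegree G)

end Graph

section Sampling

variable {V : Type*} [DecidableEq V]

/-- The probability of obtaining exactly the subset `U ⊆ T` when every `v ∈ T` is included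
independently with probability `r v`. -/
def subsetProb (T : Finset V) (r : V → ℝ) (U : Finset V) : ℝ :=
  (∏ v ∈ U, r v) * ∏ v ∈ T \ U, (1 - r v)

theorem sum_subsetProb (T : Finset V) (r : V → ℝ) :
    ∑ U ∈ T.powerset, subsetProb T r U = 1 := by
  have h := Finset.prod_add r (fun v => 1 - r v) T
  simp only [add_sub_cancel, Finset.prod_const_one] at h
  exact h.symm

open Classical in
/-- Double sampling: first choose `S'` by including every vertex `v` independently with
probability `p v`; then choose `S ⊆ S'` by including every `v ∈ S'` independently with probability
`q v / p v`. This is the probability that the pair `(S, S')` satisfies `E`. -/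
noncomputable def doubleSampleProb [Fintype V] (p q : V → ℝ)
    (E : Finset V → Finset V → Prop) : ℝ :=
  ∑ S' : Finset V, ∑ S ∈ S'.powerset,
    if E S S' then subsetProb univ p S' * subsetProb S' (fun v => q v / p v) S else 0

theorem doubleSampleProb_true [Fintype V] (p q : V → ℝ) :
    doubleSampleProb p q (fun _ _ => True) = 1 := by
  simp only [doubleSampleProb, if_true, ← Finset.mul_sum, sum_subsetProb, mul_one]
  rw [← Finset.powerset_univ]
  exact sum_subsetProb univ p

end Sampling

section LinearProgram

/-! In this section a weighted graph is given by its finite vertex set `U`, the edges of `G`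
between vertices of `U`, and the edge weights `w i j`; `γ` are the sampling probabilities, and `A`
is the chosen side of the partition `(A, S \ A)` of the seed set `S`. -/

variable {V : Type*} [DecidableEq V]

/-- The neighbours of `i` inside `U`. -/
def nbrs (G : SimpleGraph V) [DecidableRel G.Adj] (U : Finset V) (i : V) : Finset V :=
  U.filter (fun j => G.Adj i j)

/-- The weighted degree `d_i`. -/
def wdegree (G : SimpleGraph V) [DecidableRel G.Adj] (U : Finset V) (w : V → V → ℝ) (i : V) : ℝ :=
  ∑ j ∈ nbrs G U i, w i j

/-- The guess `ρ_i`: the sum of `w i j / γ j` over the neighbours `j` of `i` in `A`. -/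
noncomputable def rho (G : SimpleGraph V) [DecidableRel G.Adj] (U : Finset V) (w : V → V → ℝ)
    (γ : V → ℝ) (A : Finset V) (i : V) : ℝ :=
  ∑ j ∈ nbrs G U i ∩ A, w i j / γ j

/-- Feasibility of `(x, s, t)` for the linearized MaxCut program. Only the coordinates in `U`
matter. -/
structure LPFeasible (G : SimpleGraph V) [DecidableRel G.Adj] (U : Finset V) (w : V → V → ℝ)
    (γ : V → ℝ) (A : Finset V) (x s t : V → ℝ) : Prop where
  x_nonneg : ∀ i ∈ U, 0 ≤ x i
  x_le_one : ∀ i ∈ U, x i ≤ 1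
  s_nonneg : ∀ i ∈ U, 0 ≤ s i
  t_nonneg : ∀ i ∈ U, 0 ≤ t i
  lower : ∀ i ∈ U, rho G U w γ A i - t i ≤ ∑ j ∈ nbrs G U i, w i j * x j
  upper : ∀ i ∈ U, ∑ j ∈ nbrs G U i, w i j * x j ≤ rho G U w γ A i + s i

/-- The objective of the linearized MaxCut program. -/
noncomputable def lpObjective (G : SimpleGraph V) [DecidableRel G.Adj] (U : Finset V)
    (w : V → V → ℝ) (γ : V → ℝ) (A : Finset V) (x s t : V → ℝ) : ℝ :=
  ∑ i ∈ U, (x i * (wdegree G U w i - rho G U w γ A i) - (s i + t i))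

/-- The optimal value of the linearized MaxCut program. -/
noncomputable def lpValue (G : SimpleGraph V) [DecidableRel G.Adj] (U : Finset V)
    (w : V → V → ℝ) (γ : V → ℝ) (A : Finset V) : ℝ :=
  sSup {r : ℝ | ∃ x s t : V → ℝ, LPFeasible G U w γ A x s t ∧ r = lpObjective G U w γ A x s t}

/-- The program is feasible and bounded, so `lpValue` is a genuine supremum. -/
theorem isLUB_lpValue (G : SimpleGraph V) [DecidableRel G.Adj] (U : Finset V)
    (w : V → V → ℝ) (γ : V → ℝ) (A : Finset V) :
    IsLUB {r : ℝ | ∃ x s t : V → ℝ, LPFeasible G U w γ A x s t ∧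
      r = lpObjective G U w γ A x s t} (lpValue G U w γ A) := by
  apply isLUB_csSup
  · refine ⟨_, fun _ => 0, fun i => |rho G U w γ A i|, fun i => |rho G U w γ A i|, ?_, rfl⟩
    refine ⟨?_, ?_, ?_, ?_, ?_, ?_⟩ <;> intro i _ <;> simp
    · exact le_abs_self _
    · linarith [neg_abs_le (rho G U w γ A i)]
  · refine ⟨∑ i ∈ U, |wdegree G U w i - rho G U w γ A i|, ?_⟩
    rintro r ⟨x, s, t, h, rfl⟩
    refine Finset.sum_le_sum fun i hi => ?_
    have h0 := h.x_nonneg i hi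
    have h1 := h.x_le_one i hi
    have h2 := h.s_nonneg i hi
    have h3 := h.t_nonneg i hi
    have h4 := mul_le_mul_of_nonneg_left (le_abs_self (wdegree G U w i - rho G U w γ A i)) h0
    have h5 := mul_le_mul_of_nonneg_right h1 (abs_nonneg (wdegree G U w i - rho G U w γ A i))
    linarith

/-- The maximum of the program values over all partitions `(A, S \ A)` of the seed set `S`. -/
noncomputable def maxLP (G : SimpleGraph V) [DecidableRel G.Adj] (U : Finset V)
    (w : V → V → ℝ) (γ : V → ℝ) (S : Finset V) : ℝ :=
  S.powerset.sup' ⟨∅, Finset.empty_mem_powerset S⟩ (fun A => lpValue G U w γ A)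

end LinearProgram

section Programs

variable {V : Type*} [Fintype V] [DecidableEq V]

/-- The maximum over `A ⊆ S` of the program on the unweighted graph `G`, with sampling
probabilities `q`. -/
noncomputable def maxLPFull (G : SimpleGraph V) [DecidableRel G.Adj] (q : V → ℝ)
    (S : Finset V) : ℝ :=
  maxLP G univ (fun _ _ => 1) q S

/-- The maximum over `A ⊆ S` of the program on the weighted graph `H`, the subgraph of `G` induced
on `S'` with edge weights `1 / (p_i p_j Δ²)`, with sampling probabilities `q / p`. -/
noncomputable def maxLPSampled (G : SimpleGraph V) [DecidableRel G.Adj] (p q : V → ℝ)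
    (S S' : Finset V) : ℝ :=
  maxLP G S' (fun i j => 1 / (p i * p j * avgDegree G ^ 2)) (fun v => q v / p v) S

end Programs

end VertexSample

/-!
Write `M_i = max {d_i, ε Δ}` and `ξ_i = 1[i ∈ S'] / p_i`. The program on `G` for a side `A` of the
partition has, by the minimax theorem, a dual solution `z ∈ [-1, 1]^V` whose value
`∑ i, (ρ_i z_i + max 0 (∑_{j ~ i} (1 - z_j) - ρ_i))` is at most the optimum
(`exists_dualObjective_le`). The same `z` is feasible for the dual of the program on `H`, where its
value, multiplied by `Δ²`, is the sum with weights `ξ_i` and with `∑_{j ~ i} ξ_j (1 - z_j)` in place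
of `∑_{j ~ i} (1 - z_j)`. Hence the optimum on `H` exceeds that on `G` by at most the deviation of
the linear form `∑ ξ_i f_i`, where `f_i` is the contribution of `i` to the dual value, and the
quadratic error `∑ ξ_i |Y_i|` with `Y_i = ∑_{j ~ i} (1 - z_j) (ξ_j - 1)` (`sampled_lpValue_le`).

*Concentration.* The scores `h_i` make every vertex with `p_i ≠ 1` have influence
`M_i / p_i ≤ Δ² α_ε`, so that a Bernstein type bound for functions with bounded differences
(`bexp_exp_le`) gives deviations of order `ε n Δ` probability `exp (-c C n log n / (ε² Δ))`. The
quadratic error has no bounded differences, and is first decoupled: a uniformly random `T` separates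
each pair of neighbours with probability `1 / 4`, so the error is bounded by an average over `T` of
`4 ∑_{i ∈ T} ξ_i |Y_i^T|`, where `Y_i^T` only involves the `ξ_j` with `j ∉ T` and may be truncated
at `8 M_i` when no weighted sampled degree is atypically large. By Jensen's inequality it suffices
to bound the exponential moment for each `T`, and there the choices inside and outside `T` are
independent (`bexp_exp_decoupledError_le`).

*Union bound.* The dual solution depends on `A`, and `S` is not independent of `S'`. The event
`A ⊆ S` has probability `q ^ |A|`, and conditioning on it only forces `A` into `S'`
(`dexp_superset`); this multiplies the exponential moments by at most `exp (2 |A|)`. The sum over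
all `A` is therefore at most `(1 + e² q) ^ n ≤ exp (8 q n)`, and `q n = 16 n log n / (ε² Δ)` is
beaten by the concentration once `C` is a large constant (`doubleSampleProb_ge`).
-/

open Finset

namespace VertexSample

/-! ### Expectations over independently sampled subsets -/

section Expectation

variable {V : Type*} [DecidableEq V]

/-- The expectation of `F U`, where `U ⊆ T` contains every `v ∈ T` independently with
probability `r v`. -/
noncomputable def bexp (T : Finset V) (r : V → ℝ) (F : Finset V → ℝ) : ℝ :=
  ∑ U ∈ T.powerset, subsetProb T r U * F U

theorem subsetProb_nonneg {T : Finset V} {r : V → ℝ} (h0 : ∀ v ∈ T, 0 ≤ r v)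
    (h1 : ∀ v ∈ T, r v ≤ 1) {U : Finset V} (hU : U ⊆ T) : 0 ≤ subsetProb T r U :=
  mul_nonneg (prod_nonneg fun v hv => h0 v (hU hv))
    (prod_nonneg fun v hv => sub_nonneg.2 (h1 v (mem_sdiff.1 hv).1))

theorem bexp_empty (r : V → ℝ) (F : Finset V → ℝ) : bexp ∅ r F = F ∅ := by
  simp [bexp, subsetProb]

theorem bexp_insert {T : Finset V} {a : V} (ha : a ∉ T) (r : V → ℝ) (F : Finset V → ℝ) :
    bexp (insert a T) r F =
      r a * bexp T r (fun U => F (insert a U)) + (1 - r a) * bexp T r F := by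
  unfold bexp
  rw [sum_powerset_insert ha, add_comm, mul_sum, mul_sum]
  congr 1
  · refine sum_congr rfl fun U hU => ?_
    have haU : a ∉ U := fun h => ha (mem_powerset.1 hU h)
    have h : insert a T \ insert a U = T \ U := by
      ext v
      simp only [mem_sdiff, mem_insert]
      constructor
      · rintro ⟨rfl | h, h'⟩
        · exact absurd (Or.inl rfl) h'
        · exact ⟨h, fun hv => h' (Or.inr hv)⟩
      · rintro ⟨h, h'⟩
        exact ⟨Or.inr h, by rintro (rfl | hv); exacts [ha h, h' hv]⟩
    rw [subsetProb, subsetProb, prod_insert haU, h]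
    ring
  · refine sum_congr rfl fun U hU => ?_
    have haU : a ∉ U := fun h => ha (mem_powerset.1 hU h)
    rw [subsetProb, subsetProb, insert_sdiff_of_notMem _ haU,
      prod_insert (fun h => ha (mem_sdiff.1 h).1)]
    ring

theorem bexp_const (T : Finset V) (r : V → ℝ) (c : ℝ) : bexp T r (fun _ => c) = c := by
  rw [bexp, ← sum_mul, sum_subsetProb, one_mul]

theorem bexp_add (T : Finset V) (r : V → ℝ) (F G : Finset V → ℝ) :
    bexp T r (fun U => F U + G U) = bexp T r F + bexp T r G := by
  simp only [bexp, mul_add, sum_add_distrib]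

theorem bexp_const_mul (T : Finset V) (r : V → ℝ) (c : ℝ) (F : Finset V → ℝ) :
    bexp T r (fun U => c * F U) = c * bexp T r F := by
  simp only [bexp, mul_sum]
  exact sum_congr rfl fun U _ => by ring

theorem bexp_sum {ι : Type*} (T : Finset V) (r : V → ℝ) (s : Finset ι)
    (F : ι → Finset V → ℝ) :
    bexp T r (fun U => ∑ i ∈ s, F i U) = ∑ i ∈ s, bexp T r (F i) := by
  simp only [bexp, mul_sum]
  exact sum_comm

theorem bexp_congr {T : Finset V} {r : V → ℝ} {F G : Finset V → ℝ}
    (h : ∀ U ⊆ T, F U = G U) : bexp T r F = bexp T r G :=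
  sum_congr rfl fun U hU => by rw [h U (mem_powerset.1 hU)]

theorem bexp_mono {T : Finset V} {r : V → ℝ} (h0 : ∀ v ∈ T, 0 ≤ r v) (h1 : ∀ v ∈ T, r v ≤ 1)
    {F G : Finset V → ℝ} (h : ∀ U ⊆ T, F U ≤ G U) : bexp T r F ≤ bexp T r G :=
  sum_le_sum fun U hU => mul_le_mul_of_nonneg_left (h U (mem_powerset.1 hU))
    (subsetProb_nonneg h0 h1 (mem_powerset.1 hU))

/-- The choices made on disjoint sets are independent. -/
theorem bexp_union {T T' : Finset V} (hd : Disjoint T T') (r : V → ℝ) (F : Finset V → ℝ) :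
    bexp (T ∪ T') r F = bexp T' r (fun U' => bexp T r (fun U => F (U ∪ U'))) := by
  induction T using Finset.induction_on generalizing F with
  | empty => simp [bexp_empty]
  | insert a T ha ih =>
    rw [disjoint_insert_left] at hd
    have ha' : a ∉ T ∪ T' := by simp [ha, hd.1]
    rw [insert_union, bexp_insert ha', ih hd.2, ih hd.2]
    simp only [bexp_insert ha, bexp_add, bexp_const_mul, insert_union]

theorem bexp_prod_ite (T : Finset V) (r g h : V → ℝ) :
    bexp T r (fun U => ∏ v ∈ T, if v ∈ U then g v else h v) =
      ∏ v ∈ T, (r v * g v + (1 - r v) * h v) := by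
  induction T using Finset.induction_on with
  | empty => simp [bexp_empty]
  | insert a T ha ih =>
    have e1 : bexp T r (fun U => ∏ v ∈ insert a T, if v ∈ insert a U then g v else h v) =
        g a * bexp T r (fun U => ∏ v ∈ T, if v ∈ U then g v else h v) := by
      rw [← bexp_const_mul]
      refine bexp_congr fun U hU => ?_
      rw [prod_insert ha, if_pos (mem_insert_self a U)]
      congr 1
      refine prod_congr rfl fun v hv => ?_
      have : v ≠ a := fun h => ha (h ▸ hv)
      simp [this]
    have e2 : bexp T r (fun U => ∏ v ∈ insert a T, if v ∈ U then g v else h v) =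
        h a * bexp T r (fun U => ∏ v ∈ T, if v ∈ U then g v else h v) := by
      rw [← bexp_const_mul]
      refine bexp_congr fun U hU => ?_
      rw [prod_insert ha, if_neg (fun h => ha (hU h))]
    rw [bexp_insert ha, prod_insert ha, e1, e2, ih]
    ring

/-- The probability that the sampled set contains `A`. -/
theorem bexp_superset {T A : Finset V} (hA : A ⊆ T) (r : V → ℝ) :
    bexp T r (fun U => if A ⊆ U then 1 else 0) = ∏ v ∈ A, r v := by
  have h : ∀ U : Finset V, (if A ⊆ U then (1 : ℝ) else 0) =
      ∏ v ∈ T, if v ∈ U then 1 else if v ∈ A then 0 else 1 := by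
    intro U
    split_ifs with hU
    · refine (prod_eq_one fun v _ => ?_).symm
      by_cases hv : v ∈ U
      · simp [hv]
      · have : v ∉ A := fun h => hv (hU h)
        simp [hv, this]
    · obtain ⟨a, ha, haU⟩ := not_subset.1 hU
      exact (prod_eq_zero (hA ha) (by simp [ha, haU])).symm
  simp only [h]
  rw [bexp_prod_ite T r (fun _ => 1) (fun v => if v ∈ A then 0 else 1), ← prod_subset hA]
  · exact prod_congr rfl fun v hv => by simp [hv]
  · intro v _ hv
    simp [hv]

theorem bexp_mem {T : Finset V} {a : V} (ha : a ∈ T) (r : V → ℝ) :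
    bexp T r (fun U => if a ∈ U then 1 else 0) = r a := by
  simpa using bexp_superset (singleton_subset_iff.2 ha) r

theorem bexp_linear {T s : Finset V} (hs : s ⊆ T) (r b : V → ℝ) :
    bexp T r (fun U => ∑ v ∈ s, b v * (if v ∈ U then 1 else 0)) = ∑ v ∈ s, b v * r v := by
  rw [bexp_sum]
  exact sum_congr rfl fun v hv => by rw [bexp_const_mul, bexp_mem (hs hv)]

/-- The exponential moment of a variable with values `u` (with probability `r`) and `w`. -/
theorem exp_two_point {r u w δ v : ℝ} (h0 : 0 ≤ r) (huw : |u - w| ≤ δ) (hv : 0 ≤ v)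
    (h : r = 1 ∨ (δ ≤ 1 ∧ r * δ ^ 2 ≤ v)) :
    r * Real.exp u + (1 - r) * Real.exp w ≤ Real.exp (r * u + (1 - r) * w + v) := by
  rcases h with rfl | ⟨hδ, hrδ⟩
  · simp only [one_mul, sub_self, zero_mul, add_zero]
    exact Real.exp_le_exp.2 (by linarith)
  · have h1 := (abs_le.1 (Real.abs_exp_sub_one_sub_id_le (huw.trans hδ))).2
    have h2 : (u - w) ^ 2 ≤ δ ^ 2 := by
      rw [← sq_abs (u - w)]
      exact pow_le_pow_left₀ (abs_nonneg _) huw 2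
    have h3 : r * (Real.exp (u - w) - 1) ≤ r * (u - w) + v := by
      have := mul_le_mul_of_nonneg_left (h1.trans h2) h0
      nlinarith
    have h4 := Real.add_one_le_exp (r * (u - w) + v)
    have h5 : Real.exp u = Real.exp w * Real.exp (u - w) := by
      rw [← Real.exp_add]; congr 1; ring
    have h6 : Real.exp (r * u + (1 - r) * w + v) =
        Real.exp w * Real.exp (r * (u - w) + v) := by
      rw [← Real.exp_add]; congr 1; ring
    rw [h6, h5]
    have h7 := mul_le_mul_of_nonneg_left (h4.trans' (add_le_add_left h3 1)) (Real.exp_pos w).le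
    nlinarith

/-- A Bernstein type bound for the exponential moment of a function with bounded differences.
The variance proxy of a coordinate that is sampled with probability `r` and changes `F` by at most
`δ ≤ 1` is `r δ²`; a coordinate sampled with probability `1` costs nothing, however large its
influence. -/
theorem bexp_exp_le {T : Finset V} {r δ v : V → ℝ} (h0 : ∀ j ∈ T, 0 ≤ r j)
    (h1 : ∀ j ∈ T, r j ≤ 1) (hv : ∀ j ∈ T, 0 ≤ v j)
    (h : ∀ j ∈ T, r j = 1 ∨ (δ j ≤ 1 ∧ r j * δ j ^ 2 ≤ v j)) (F : Finset V → ℝ)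
    (hF : ∀ j ∈ T, ∀ U ⊆ T, |F (insert j U) - F U| ≤ δ j) :
    bexp T r (fun U => Real.exp (F U)) ≤ Real.exp (bexp T r F + ∑ j ∈ T, v j) := by
  induction T using Finset.induction_on generalizing F with
  | empty => simp [bexp_empty]
  | insert a T ha ih =>
    have hT := subset_insert a T
    have haT := mem_insert_self a T
    have ih' := fun F hF => ih (fun j hj => h0 j (hT hj)) (fun j hj => h1 j (hT hj))
      (fun j hj => hv j (hT hj)) (fun j hj => h j (hT hj)) F hF
    have e1 := ih' (fun U => F (insert a U)) (fun j hj U hU => by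
      rw [insert_comm]
      exact hF j (hT hj) _ (insert_subset_insert a hU))
    have e2 := ih' F (fun j hj U hU => hF j (hT hj) U (hU.trans hT))
    have hdiff : |bexp T r (fun U => F (insert a U)) - bexp T r F| ≤ δ a := by
      have hT0 : ∀ j ∈ T, 0 ≤ r j := fun j hj => h0 j (hT hj)
      have hT1 : ∀ j ∈ T, r j ≤ 1 := fun j hj => h1 j (hT hj)
      have hle : bexp T r (fun U => F (insert a U)) ≤ bexp T r (fun U => F U + δ a) :=
        bexp_mono hT0 hT1 fun U hU => by
          linarith [(abs_le.1 (hF a haT U (hU.trans hT))).2]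
      have hge : bexp T r F ≤ bexp T r (fun U => F (insert a U) + δ a) :=
        bexp_mono hT0 hT1 fun U hU => by
          linarith [(abs_le.1 (hF a haT U (hU.trans hT))).1]
      rw [bexp_add, bexp_const] at hle hge
      exact abs_le.2 ⟨by linarith, by linarith⟩
    rw [bexp_insert ha, bexp_insert ha, sum_insert ha]
    have e3 := exp_two_point (h0 a haT) hdiff (hv a haT) (h a haT)
    calc _ ≤ r a * Real.exp (bexp T r (fun U => F (insert a U)) + ∑ j ∈ T, v j) +
          (1 - r a) * Real.exp (bexp T r F + ∑ j ∈ T, v j) :=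
          add_le_add (mul_le_mul_of_nonneg_left e1 (h0 a haT))
            (mul_le_mul_of_nonneg_left e2 (sub_nonneg.2 (h1 a haT)))
      _ = (r a * Real.exp (bexp T r (fun U => F (insert a U))) +
          (1 - r a) * Real.exp (bexp T r F)) * Real.exp (∑ j ∈ T, v j) := by
          rw [Real.exp_add, Real.exp_add]; ring
      _ ≤ _ := by
          refine (mul_le_mul_of_nonneg_right e3 (Real.exp_pos _).le).trans_eq ?_
          rw [← Real.exp_add]; congr 1; ring

/-- A function with bounded differences and total variance proxy at most `1 / s²` has mean
absolute deviation `O (1 / s)`. -/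
theorem bexp_abs_sub_le {T : Finset V} {r δ v : V → ℝ} {s : ℝ} (hs : 0 < s)
    (h0 : ∀ j ∈ T, 0 ≤ r j) (h1 : ∀ j ∈ T, r j ≤ 1) (hv : ∀ j ∈ T, 0 ≤ v j)
    (h : ∀ j ∈ T, r j = 1 ∨ (s * δ j ≤ 1 ∧ r j * (s * δ j) ^ 2 ≤ v j))
    (hsum : ∑ j ∈ T, v j ≤ 1) (F : Finset V → ℝ)
    (hF : ∀ j ∈ T, ∀ U ⊆ T, |F (insert j U) - F U| ≤ δ j) :
    bexp T r (fun U => |F U - bexp T r F|) ≤ 6 / s := by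
  have key : ∀ σ : ℝ, |σ| = 1 →
      bexp T r (fun U => Real.exp (σ * s * (F U - bexp T r F))) ≤ 3 := by
    intro σ hσ
    have e := bexp_exp_le (δ := fun j => s * δ j) h0 h1 hv h
      (fun U => σ * s * (F U - bexp T r F)) (fun j hj U hU => by
        rw [← mul_sub, sub_sub_sub_cancel_right, abs_mul, abs_mul, hσ, one_mul, abs_of_pos hs]
        exact mul_le_mul_of_nonneg_left (hF j hj U hU) hs.le)
    have hz : bexp T r (fun U => σ * s * (F U - bexp T r F)) = 0 := by
      rw [bexp_const_mul]
      simp only [sub_eq_add_neg]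
      rw [bexp_add, bexp_const]
      ring
    rw [hz, zero_add] at e
    exact e.trans ((Real.exp_le_exp.2 hsum).trans Real.exp_one_lt_three.le)
  have k1 := key 1 (by simp)
  have k2 := key (-1) (by simp)
  have hle : bexp T r (fun U => s * |F U - bexp T r F|) ≤
      bexp T r (fun U => Real.exp (1 * s * (F U - bexp T r F)) +
        Real.exp (-1 * s * (F U - bexp T r F))) := by
    refine bexp_mono h0 h1 fun U _ => ?_
    have p1 := Real.exp_pos (1 * s * (F U - bexp T r F))
    have p2 := Real.exp_pos (-1 * s * (F U - bexp T r F))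
    have q1 := Real.add_one_le_exp (1 * s * (F U - bexp T r F))
    have q2 := Real.add_one_le_exp (-1 * s * (F U - bexp T r F))
    rcases abs_cases (F U - bexp T r F) with ⟨h, _⟩ | ⟨h, _⟩ <;> rw [h] <;> linarith
  rw [bexp_const_mul, bexp_add] at hle
  rw [le_div_iff₀ hs]
  linarith

end Expectation

/-! ### Duality for the linearized MaxCut program -/

section Duality

variable {V : Type*} [DecidableEq V]

/-- The value of the dual of the linearized MaxCut program at `z ∈ [-1, 1]^U`, where `z i` is the
multiplier of the constraints on `∑ j, w i j * x j`; the multipliers of `x i ≤ 1` have been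
eliminated, which produces the positive parts. -/
noncomputable def dualObjective (G : SimpleGraph V) [DecidableRel G.Adj] (U : Finset V)
    (w : V → V → ℝ) (γ : V → ℝ) (A : Finset V) (z : V → ℝ) : ℝ :=
  ∑ i ∈ U, (rho G U w γ A i * z i +
    max 0 (wdegree G U w i - rho G U w γ A i - ∑ j ∈ nbrs G U i, w i j * z j))

/-- The Lagrangian of the linearized MaxCut program. -/
noncomputable def lagrangian (G : SimpleGraph V) [DecidableRel G.Adj] (U : Finset V)
    (w : V → V → ℝ) (γ : V → ℝ) (A : Finset V) (z x : V → ℝ) : ℝ :=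
  ∑ i ∈ U, (x i * (wdegree G U w i - rho G U w γ A i) +
    z i * (rho G U w γ A i - ∑ j ∈ nbrs G U i, w i j * x j))

omit [DecidableEq V] in
theorem sum_nbrs_comm (G : SimpleGraph V) [DecidableRel G.Adj] (U : Finset V)
    (f : V → V → ℝ) :
    ∑ i ∈ U, ∑ j ∈ nbrs G U i, f i j = ∑ i ∈ U, ∑ j ∈ nbrs G U i, f j i := by
  simp only [nbrs, sum_filter]
  rw [sum_comm]
  simp only [G.adj_comm]

variable (G : SimpleGraph V) [DecidableRel G.Adj] (U : Finset V) {w : V → V → ℝ} (γ : V → ℝ)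
  (A : Finset V)

theorem lagrangian_eq (hw : ∀ i j, w i j = w j i) (z x : V → ℝ) :
    lagrangian G U w γ A z x = ∑ i ∈ U, (rho G U w γ A i * z i +
      x i * (wdegree G U w i - rho G U w γ A i - ∑ j ∈ nbrs G U i, w i j * z j)) := by
  have h : ∑ i ∈ U, z i * ∑ j ∈ nbrs G U i, w i j * x j =
      ∑ i ∈ U, x i * ∑ j ∈ nbrs G U i, w i j * z j := by
    simp only [mul_sum]
    rw [sum_nbrs_comm]
    refine sum_congr rfl fun i _ => sum_congr rfl fun j _ => ?_
    rw [hw j i]; ring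
  unfold lagrangian
  simp only [sum_add_distrib, mul_sub, sum_sub_distrib, h]
  have : ∑ i ∈ U, z i * rho G U w γ A i = ∑ i ∈ U, rho G U w γ A i * z i :=
    sum_congr rfl fun i _ => mul_comm _ _
  rw [this]; ring

theorem lpValue_le_dualObjective (hw : ∀ i j, w i j = w j i) {z : V → ℝ}
    (hz : ∀ i, |z i| ≤ 1) : lpValue G U w γ A ≤ dualObjective G U w γ A z := by
  refine (isLUB_lpValue G U w γ A).2 ?_
  rintro r ⟨x, s, t, h, rfl⟩
  have h1 : lpObjective G U w γ A x s t ≤ lagrangian G U w γ A z x := by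
    refine sum_le_sum fun i hi => ?_
    have a1 := h.s_nonneg i hi
    have a2 := h.t_nonneg i hi
    have a3 := h.lower i hi
    have a4 := h.upper i hi
    have a5 : |rho G U w γ A i - ∑ j ∈ nbrs G U i, w i j * x j| ≤ s i + t i :=
      abs_le.2 ⟨by linarith, by linarith⟩
    have a6 := neg_abs_le (z i * (rho G U w γ A i - ∑ j ∈ nbrs G U i, w i j * x j))
    rw [abs_mul] at a6
    have a7 := mul_le_mul (hz i) a5 (abs_nonneg _) zero_le_one
    linarith
  refine h1.trans ?_
  rw [lagrangian_eq G U γ A hw]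
  refine sum_le_sum fun i hi => ?_
  gcongr
  set c := wdegree G U w i - rho G U w γ A i - ∑ j ∈ nbrs G U i, w i j * z j
  have b1 := mul_le_mul_of_nonneg_left (le_max_right 0 c) (h.x_nonneg i hi)
  have b2 := mul_le_mul_of_nonneg_right (h.x_le_one i hi) (le_max_left 0 c)
  linarith

theorem lagrangian_affine_left {a b : ℝ} (hab : a + b = 1) (z z' x : V → ℝ) :
    lagrangian G U w γ A (a • z + b • z') x =
      a * lagrangian G U w γ A z x + b * lagrangian G U w γ A z' x := by
  simp only [lagrangian, mul_sum]
  rw [← sum_add_distrib]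
  refine sum_congr rfl fun i _ => ?_
  simp only [Pi.add_apply, Pi.smul_apply, smul_eq_mul]
  linear_combination (-(x i * (wdegree G U w i - rho G U w γ A i))) * hab

theorem lagrangian_affine_right {a b : ℝ} (hab : a + b = 1) (z x x' : V → ℝ) :
    lagrangian G U w γ A z (a • x + b • x') =
      a * lagrangian G U w γ A z x + b * lagrangian G U w γ A z x' := by
  simp only [lagrangian]
  rw [mul_sum, mul_sum, ← sum_add_distrib]
  refine sum_congr rfl fun i _ => ?_
  have h : ∑ j ∈ nbrs G U i, w i j * (a • x + b • x') j =
      a * ∑ j ∈ nbrs G U i, w i j * x j + b * ∑ j ∈ nbrs G U i, w i j * x' j := by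
    rw [mul_sum, mul_sum, ← sum_add_distrib]
    refine sum_congr rfl fun j _ => ?_
    simp only [Pi.add_apply, Pi.smul_apply, smul_eq_mul]
    ring
  rw [h]
  simp only [Pi.add_apply, Pi.smul_apply, smul_eq_mul]
  linear_combination (-(z i * rho G U w γ A i)) * hab

/-- Strong duality, from the minimax theorem for the Lagrangian on `[-1, 1]^V × [0, 1]^V`. -/
theorem exists_dualObjective_le (hw : ∀ i j, w i j = w j i) :
    ∃ z : V → ℝ, (∀ i, |z i| ≤ 1) ∧ dualObjective G U w γ A z ≤ lpValue G U w γ A := by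
  obtain ⟨z, hz, x, hx, hsad⟩ := Sion.exists_isSaddlePointOn
    (X := Set.Icc (-1 : V → ℝ) 1) (Y := Set.Icc (0 : V → ℝ) 1)
    (f := lagrangian G U w γ A)
    ⟨0, by constructor <;> intro i <;> simp⟩ (convex_Icc _ _) isCompact_Icc
    (fun x _ => (Continuous.lowerSemicontinuous
      (by unfold lagrangian; fun_prop)).lowerSemicontinuousOn _)
    (fun x _ => ConvexOn.quasiconvexOn ⟨convex_Icc _ _, fun z _ z' _ a b _ _ hab =>
      (lagrangian_affine_left G U γ A hab z z' x).le⟩)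
    (convex_Icc _ _) ⟨0, by constructor <;> intro i <;> simp⟩ isCompact_Icc
    (fun z _ => (Continuous.upperSemicontinuous
      (by unfold lagrangian; fun_prop)).upperSemicontinuousOn _)
    (fun z _ => ConcaveOn.quasiconcaveOn ⟨convex_Icc _ _, fun x _ x' _ a b _ _ hab =>
      (lagrangian_affine_right G U γ A hab z x x').ge⟩)
  refine ⟨z, fun i => abs_le.2 ⟨hz.1 i, hz.2 i⟩, ?_⟩
  -- The maximizing `x` for the multiplier `z` is an indicator function.
  let c : V → ℝ := fun i => wdegree G U w i - rho G U w γ A i - ∑ j ∈ nbrs G U i, w i j * z j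
  let x₁ : V → ℝ := fun i => if 0 ≤ c i then 1 else 0
  have hx₁ : x₁ ∈ Set.Icc (0 : V → ℝ) 1 := by
    constructor <;> intro i <;> simp only [x₁, Pi.zero_apply, Pi.one_apply] <;> split_ifs <;> simp
  -- The minimizing multiplier for `x` is a sign vector.
  let y : V → ℝ := fun i => rho G U w γ A i - ∑ j ∈ nbrs G U i, w i j * x j
  let z₁ : V → ℝ := fun i => if 0 ≤ y i then -1 else 1
  have hz₁ : z₁ ∈ Set.Icc (-1 : V → ℝ) 1 := by
    constructor <;> intro i <;> simp only [z₁, Pi.neg_apply, Pi.one_apply] <;> split_ifs <;> simp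
  have h1 : dualObjective G U w γ A z = lagrangian G U w γ A z x₁ := by
    rw [lagrangian_eq G U γ A hw]
    refine sum_congr rfl fun i _ => ?_
    change _ + max 0 (c i) = _ + x₁ i * c i
    simp only [x₁]
    split_ifs with h
    · rw [max_eq_right h, one_mul]
    · rw [max_eq_left (not_le.1 h).le, zero_mul]
  rw [h1]
  refine (hsad z₁ hz₁ x₁ hx₁).trans ((isLUB_lpValue G U w γ A).1
    ⟨x, fun i => max 0 (-y i), fun i => max 0 (y i), ⟨fun i _ => hx.1 i, fun i _ => hx.2 i,
      fun i _ => le_max_left _ _, fun i _ => le_max_left _ _, fun i _ => ?_, fun i _ => ?_⟩, ?_⟩)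
  · have := le_max_right 0 (y i)
    simp only [y] at this ⊢
    linarith
  · have := le_max_right 0 (-y i)
    simp only [y] at this ⊢
    linarith
  · refine sum_congr rfl fun i _ => ?_
    change _ + z₁ i * y i = _ - (max 0 (-y i) + max 0 (y i))
    simp only [z₁]
    split_ifs with h
    · rw [max_eq_right h, max_eq_left (by linarith)]; ring
    · rw [max_eq_left (not_le.1 h).le, max_eq_right (by linarith [not_le.1 h])]; ring

end Duality

/-! ### The sampled program against the dual solution of the full program -/

section Sampled

variable {V : Type*} [DecidableEq V]

/-- The inverse probability weight `ξ_i = 1[i ∈ U] / p_i`. -/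
noncomputable def ipw (p : V → ℝ) (U : Finset V) (i : V) : ℝ :=
  1 / p i * (if i ∈ U then 1 else 0)

theorem ipw_nonneg {p : V → ℝ} (hp : ∀ i, 0 < p i) (U : Finset V) (i : V) : 0 ≤ ipw p U i :=
  mul_nonneg (one_div_nonneg.2 (hp i).le) (by split_ifs <;> simp)

variable [Fintype V] (G : SimpleGraph V) [DecidableRel G.Adj]

/-- The guess `ρ_i` on the unweighted graph `G`, with uniform seed probability `q`. -/
noncomputable def guess (q : ℝ) (A : Finset V) (i : V) : ℝ :=
  rho G univ (fun _ _ => 1) (fun _ => q) A i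

/-- The contribution of the vertex `i` to the dual objective of `G`. -/
noncomputable def dualTerm (q : ℝ) (A : Finset V) (z : V → ℝ) (i : V) : ℝ :=
  guess G q A i * z i + max 0 (∑ j ∈ nbrs G univ i, (1 - z j) - guess G q A i)

/-- The sampling error `∑_{j ~ i} c_j (ξ_j - 1)` at the vertex `i`. -/
noncomputable def nbrError (p c : V → ℝ) (U : Finset V) (i : V) : ℝ :=
  ∑ j ∈ nbrs G univ i, c j * (ipw p U j - 1)

theorem guess_nonneg {q : ℝ} (hq : 0 < q) (A : Finset V) (i : V) : 0 ≤ guess G q A i :=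
  sum_nonneg fun _ _ => by positivity

omit [DecidableEq V] in
theorem card_nbrs_univ (i : V) : ((nbrs G univ i).card : ℝ) = G.degree i := by
  rw [← G.card_neighborFinset_eq_degree i]
  congr 2
  ext j
  simp [nbrs]

theorem dualObjective_univ (q : ℝ) (A : Finset V) (z : V → ℝ) :
    dualObjective G univ (fun _ _ => 1) (fun _ => q) A z = ∑ i, dualTerm G q A z i := by
  refine sum_congr rfl fun i _ => ?_
  simp only [dualTerm, guess, wdegree, sum_sub_distrib, one_mul]
  congr 2
  ring

theorem abs_dualTerm_le {q : ℝ} (hq : 0 < q) (A : Finset V) {z : V → ℝ} (hz : ∀ i, |z i| ≤ 1)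
    (i : V) : |dualTerm G q A z i| ≤ guess G q A i + 2 * G.degree i := by
  have h0 := guess_nonneg G hq A i
  have hs0 : 0 ≤ ∑ j ∈ nbrs G univ i, (1 - z j) :=
    sum_nonneg fun j _ => by linarith [(abs_le.1 (hz j)).2]
  have hs1 : ∑ j ∈ nbrs G univ i, (1 - z j) ≤ 2 * G.degree i := by
    rw [← card_nbrs_univ, mul_comm, ← nsmul_eq_mul]
    exact sum_le_card_nsmul _ _ _ fun j _ => by linarith [(abs_le.1 (hz j)).1]
  have hz1 := abs_le.1 (hz i)
  unfold dualTerm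
  rcases le_total 0 (∑ j ∈ nbrs G univ i, (1 - z j) - guess G q A i) with h | h
  · rw [max_eq_right h, abs_le]
    constructor <;> nlinarith
  · rw [max_eq_left h, abs_le]
    constructor <;> nlinarith

/-- The weights of the sampled graph make the guess of every sampled vertex the guess in the full
graph, scaled by `1 / (p_i Δ²)`. -/
theorem rho_sampled {p : V → ℝ} (hp : ∀ i, 0 < p i) {q D : ℝ} {A U : Finset V} (hA : A ⊆ U)
    (i : V) :
    rho G U (fun i j => 1 / (p i * p j * D ^ 2)) (fun v => q / p v) A i =
      1 / p i * guess G q A i / D ^ 2 := by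
  have h : nbrs G U i ∩ A = nbrs G univ i ∩ A := by
    ext j
    simp only [nbrs, mem_inter, mem_filter, mem_univ, true_and]
    exact ⟨fun h => ⟨h.1.2, h.2⟩, fun h => ⟨⟨hA h.2, h.1⟩, h.2⟩⟩
  rw [guess, rho, rho, h, mul_sum, sum_div]
  refine sum_congr rfl fun j _ => ?_
  have := (hp i).ne'
  have := (hp j).ne'
  rcases eq_or_ne q 0 with rfl | hq
  · simp
  rcases eq_or_ne D 0 with rfl | hD
  · simp
  field_simp

theorem sum_nbrs_sampled (p c : V → ℝ) (D : ℝ) (U : Finset V) (i : V) :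
    ∑ j ∈ nbrs G U i, 1 / (p i * p j * D ^ 2) * c j =
      1 / p i * (∑ j ∈ nbrs G univ i, c j * ipw p U j) / D ^ 2 := by
  have h : nbrs G U i = (nbrs G univ i).filter (· ∈ U) := by
    ext j
    simp only [nbrs, mem_filter, mem_univ, true_and]
    exact and_comm
  rw [h, sum_filter, mul_sum, sum_div]
  refine sum_congr rfl fun j _ => ?_
  unfold ipw
  split_ifs
  · simp only [one_div, mul_inv]
    ring
  · simp

/-- The sampled program is bounded by the empirical value of any dual solution `z` of the full
program, up to the sampling errors inside the positive parts. -/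
theorem sampled_lpValue_le {p : V → ℝ} (hp : ∀ i, 0 < p i) {q D : ℝ} (hD : 0 < D)
    {A U : Finset V} (hA : A ⊆ U) {z : V → ℝ} (hz : ∀ i, |z i| ≤ 1) :
    D ^ 2 * lpValue G U (fun i j => 1 / (p i * p j * D ^ 2)) (fun v => q / p v) A ≤
      ∑ i, dualTerm G q A z i * ipw p U i +
        ∑ i, ipw p U i * |nbrError G p (fun j => 1 - z j) U i| := by
  have h1 := lpValue_le_dualObjective G U (w := fun i j => 1 / (p i * p j * D ^ 2))
    (fun v => q / p v) A (fun i j => by rw [mul_comm (p i)]) hz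
  refine (mul_le_mul_of_nonneg_left h1 (sq_nonneg D)).trans ?_
  have h2 : ∀ i, D ^ 2 * (rho G U (fun i j => 1 / (p i * p j * D ^ 2)) (fun v => q / p v) A i * z i +
      max 0 (wdegree G U (fun i j => 1 / (p i * p j * D ^ 2)) i -
        rho G U (fun i j => 1 / (p i * p j * D ^ 2)) (fun v => q / p v) A i -
        ∑ j ∈ nbrs G U i, 1 / (p i * p j * D ^ 2) * z j)) =
      1 / p i * (guess G q A i * z i +
        max 0 (∑ j ∈ nbrs G univ i, (1 - z j) * ipw p U j - guess G q A i)) := by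
    intro i
    have e1 : wdegree G U (fun i j => 1 / (p i * p j * D ^ 2)) i =
        1 / p i * (∑ j ∈ nbrs G univ i, 1 * ipw p U j) / D ^ 2 := by
      rw [← sum_nbrs_sampled]
      simp [wdegree]
    rw [e1, rho_sampled G hp hA, sum_nbrs_sampled]
    have e2 : 1 / p i * (∑ j ∈ nbrs G univ i, 1 * ipw p U j) / D ^ 2 -
        1 / p i * guess G q A i / D ^ 2 - 1 / p i * (∑ j ∈ nbrs G univ i, z j * ipw p U j) / D ^ 2
        = 1 / p i / D ^ 2 *
          (∑ j ∈ nbrs G univ i, (1 - z j) * ipw p U j - guess G q A i) := by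
      simp only [sub_mul, sum_sub_distrib]
      ring
    have hc : 0 ≤ 1 / p i / D ^ 2 := by have := hp i; positivity
    have e6 : ∀ x, max 0 (1 / p i / D ^ 2 * x) = 1 / p i / D ^ 2 * max 0 x := fun x => by
      rw [mul_max_of_nonneg _ _ hc, mul_zero]
    rw [e2, e6]
    field_simp
  have h3 : ∀ F : V → ℝ, ∑ i ∈ U, 1 / p i * F i = ∑ i, ipw p U i * F i := by
    intro F
    simp [ipw, ite_mul, sum_ite_mem]
  rw [dualObjective, mul_sum, sum_congr rfl fun i _ => h2 i, h3, ← sum_add_distrib]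
  refine sum_le_sum fun i _ => ?_
  rw [mul_comm (dualTerm G q A z i), ← mul_add]
  refine mul_le_mul_of_nonneg_left ?_ (ipw_nonneg hp U i)
  have e3 : ∑ j ∈ nbrs G univ i, (1 - z j) * ipw p U j =
      ∑ j ∈ nbrs G univ i, (1 - z j) + nbrError G p (fun j => 1 - z j) U i := by
    rw [nbrError, ← sum_add_distrib]
    exact sum_congr rfl fun j _ => by ring
  have e4 := le_abs_self (nbrError G p (fun j => 1 - z j) U i)
  have e5 := abs_nonneg (nbrError G p (fun j => 1 - z j) U i)
  rw [dualTerm, e3, add_assoc]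
  gcongr
  refine max_le (add_nonneg (le_max_left _ _) e5) ?_
  have := le_max_right 0 (∑ j ∈ nbrs G univ i, (1 - z j) - guess G q A i)
  linarith

end Sampled

/-! ### Exponential moments of inverse probability weighted sums -/

section Linear

variable {V : Type*} [DecidableEq V]

theorem bexp_nonneg {T : Finset V} {r : V → ℝ} (h0 : ∀ v, 0 ≤ r v) (h1 : ∀ v, r v ≤ 1)
    {F : Finset V → ℝ} (h : ∀ U, 0 ≤ F U) : 0 ≤ bexp T r F := by
  have := bexp_mono (T := T) (fun v _ => h0 v) (fun v _ => h1 v) (F := fun _ => 0) (G := F)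
    (fun U _ => h U)
  rwa [bexp_const] at this

/-- Jensen's inequality for the exponential. -/
theorem exp_bexp_le {T : Finset V} {r : V → ℝ} (h0 : ∀ v, 0 ≤ r v) (h1 : ∀ v, r v ≤ 1)
    (F : Finset V → ℝ) : Real.exp (bexp T r F) ≤ bexp T r (fun U => Real.exp (F U)) := by
  set m := bexp T r F with hm
  have h : bexp T r (fun U => Real.exp m * (F U + (1 - m))) ≤
      bexp T r (fun U => Real.exp (F U)) := by
    refine bexp_mono (fun v _ => h0 v) (fun v _ => h1 v) fun U _ => ?_
    have e : Real.exp (F U) = Real.exp m * Real.exp (F U - m) := by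
      rw [← Real.exp_add]; congr 1; ring
    rw [e]
    exact mul_le_mul_of_nonneg_left (by linarith [Real.add_one_le_exp (F U - m)])
      (Real.exp_pos m).le
  rw [bexp_const_mul, bexp_add, bexp_const, ← hm] at h
  simpa using h

theorem bexp_comm (T T' : Finset V) (r r' : V → ℝ) (F : Finset V → Finset V → ℝ) :
    bexp T r (fun U => bexp T' r' (F U)) = bexp T' r' (fun U' => bexp T r (fun U => F U U')) := by
  simp only [bexp, mul_sum]
  rw [sum_comm]
  exact sum_congr rfl fun U' _ => sum_congr rfl fun U _ => by ring

theorem abs_ipw_insert_sub {p : V → ℝ} (hp : ∀ i, 0 < p i) (j : V) (U : Finset V) (i : V) :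
    |ipw p (insert j U) i - ipw p U i| ≤ if i = j then 1 / p j else 0 := by
  unfold ipw
  by_cases hij : i = j
  · subst hij
    have := hp i
    by_cases hi : i ∈ U
    · simpa [hi] using this.le
    · simp [hi, abs_of_pos this]
  · simp [hij]

theorem abs_sum_ipw_insert_sub {p : V → ℝ} (hp : ∀ i, 0 < p i) (s : Finset V) (b : V → ℝ) (j : V)
    (U : Finset V) :
    |∑ i ∈ s, b i * ipw p (insert j U) i - ∑ i ∈ s, b i * ipw p U i| ≤
      if j ∈ s then |b j| / p j else 0 := by
  rw [← sum_sub_distrib]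
  refine (abs_sum_le_sum_abs _ _).trans ?_
  calc _ ≤ ∑ i ∈ s, |b i| * (if i = j then 1 / p j else 0) := by
        refine sum_le_sum fun i _ => ?_
        rw [← mul_sub, abs_mul]
        exact mul_le_mul_of_nonneg_left (abs_ipw_insert_sub hp j U i) (abs_nonneg _)
    _ = _ := by
        simp only [mul_ite, mul_zero, sum_ite_eq', mul_one_div]

theorem bexp_sum_ipw {T s : Finset V} (hs : s ⊆ T) (r p b : V → ℝ) :
    bexp T r (fun U => ∑ i ∈ s, b i * ipw p U i) = ∑ i ∈ s, b i * (r i / p i) := by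
  have h := bexp_linear hs r (fun i => b i / p i)
  calc _ = bexp T r (fun U => ∑ i ∈ s, b i / p i * (if i ∈ U then 1 else 0)) :=
        bexp_congr fun U _ => sum_congr rfl fun i _ => by rw [ipw]; ring
    _ = _ := by rw [h]; exact sum_congr rfl fun i _ => by ring

theorem bexp_exp_sum_ipw_le {T s : Finset V} (hs : s ⊆ T) {p r b v : V → ℝ}
    (hp : ∀ i, 0 < p i) (h0 : ∀ i, 0 ≤ r i) (h1 : ∀ i, r i ≤ 1)
    (hv : ∀ i ∈ s, 0 ≤ v i)
    (h : ∀ i ∈ s, r i = 1 ∨ (|b i| / p i ≤ 1 ∧ r i * (|b i| / p i) ^ 2 ≤ v i)) :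
    bexp T r (fun U => Real.exp (∑ i ∈ s, b i * ipw p U i)) ≤
      Real.exp (∑ i ∈ s, b i * (r i / p i) + ∑ i ∈ s, v i) := by
  have e := bexp_exp_le (T := T) (r := r) (δ := fun j => if j ∈ s then |b j| / p j else 0)
    (v := fun j => if j ∈ s then v j else 0) (fun j _ => h0 j) (fun j _ => h1 j)
    (fun j _ => by split_ifs with hj; exacts [hv j hj, le_rfl])
    (fun j _ => by
      by_cases hj : j ∈ s
      · simpa only [if_pos hj] using h j hj
      · right; simp [hj])
    (fun U => ∑ i ∈ s, b i * ipw p U i)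
    (fun j _ U _ => abs_sum_ipw_insert_sub hp s b j U)
  rwa [bexp_sum_ipw hs, sum_ite_mem, inter_eq_right.2 hs] at e

/-- The inclusion probabilities of the law of `S'` conditioned on `A ⊆ S`. -/
def condProb (p : V → ℝ) (A : Finset V) (j : V) : ℝ := if j ∈ A then 1 else p j

section

variable {p : V → ℝ} (hp : ∀ i, 0 < p i) (hp1 : ∀ i, p i ≤ 1) (A : Finset V)

include hp1 in
theorem condProb_le_one (j : V) : condProb p A j ≤ 1 := by
  unfold condProb; split_ifs; exacts [le_rfl, hp1 j]

include hp

theorem condProb_nonneg (j : V) : 0 ≤ condProb p A j := by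
  unfold condProb; split_ifs; exacts [zero_le_one, (hp j).le]

include hp1 in
theorem bias_nonneg (j : V) : 0 ≤ condProb p A j / p j - 1 := by
  rw [sub_nonneg, one_le_div (hp j)]
  unfold condProb; split_ifs; exacts [hp1 j, le_rfl]

variable {lam τ : ℝ} {M : V → ℝ} (hlam : 0 ≤ lam) (hτ : 0 ≤ τ) (hM : ∀ i, 0 ≤ M i)
  (hpM : ∀ i, p i = 1 ∨ lam * M i ≤ τ * p i)

include hlam hτ hM hpM in
/-- The bias of the weights caused by the conditioning is confined to `A`, where it is compensated
by the importance sampling. -/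
theorem mul_bias_le (j : V) :
    lam * M j * (condProb p A j / p j - 1) ≤ if j ∈ A then τ else 0 := by
  unfold condProb
  split_ifs with hj
  · rcases hpM j with h | h
    · simp [h, hτ]
    · have h2 := mul_nonneg hlam (hM j)
      have h3 : lam * M j / p j ≤ τ := (div_le_iff₀ (hp j)).2 h
      calc _ = lam * M j / p j - lam * M j := by ring
        _ ≤ _ := by linarith
  · rw [div_self (hp j).ne', sub_self, mul_zero]

include hlam hM hpM in
/-- The hypothesis of `bexp_exp_le` for a function that changes by at most `K lam M_j / p_j` when
`j` is added to the sample. -/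
theorem variance_le {K : ℝ} (hK : 0 ≤ K) (hKτ : K * τ ≤ 1) (j : V) :
    condProb p A j = 1 ∨ (K * lam * M j / p j ≤ 1 ∧
      condProb p A j * (K * lam * M j / p j) ^ 2 ≤ K ^ 2 * lam * τ * M j) := by
  unfold condProb
  split_ifs with hj
  · exact Or.inl rfl
  rcases hpM j with h | h
  · exact Or.inl h
  right
  have hpj := hp j
  have h3 : lam * M j / p j ≤ τ := (div_le_iff₀ hpj).2 h
  constructor
  · calc _ = K * (lam * M j / p j) := by ring
      _ ≤ K * τ := mul_le_mul_of_nonneg_left h3 hK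
      _ ≤ 1 := hKτ
  · calc _ = K ^ 2 * (lam * M j) * (lam * M j / p j) := by field_simp
      _ ≤ K ^ 2 * (lam * M j) * τ :=
        mul_le_mul_of_nonneg_left h3 (mul_nonneg (sq_nonneg K) (mul_nonneg hlam (hM j)))
      _ = _ := by ring

include hp1 hlam hτ hM hpM in
/-- The exponential moment of a linear form in the weights `ξ_i`. The conditioning on `A ⊆ S` costs
a factor `exp |A|`, which a union bound over `A` with weights `q ^ |A|` can afford. -/
theorem bexp_exp_linear_le [Fintype V] (T : Finset V) {K : ℝ} (hK : 0 ≤ K) (hKτ : K * τ ≤ 1) {b : V → ℝ}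
    (hb : ∀ i, |b i| ≤ K * M i) :
    bexp T (condProb p A) (fun U => Real.exp (lam * ∑ i ∈ T, b i * ipw p U i)) ≤
      Real.exp (lam * ∑ i ∈ T, b i + A.card + K ^ 2 * lam * τ * ∑ i, M i) := by
  have hvar := variance_le hp A hlam hM hpM hK hKτ
  have hbp : ∀ i, |lam * b i| / p i ≤ K * lam * M i / p i := fun i => by
    rw [abs_mul, abs_of_nonneg hlam]
    have := hp i
    refine div_le_div_of_nonneg_right ?_ this.le
    calc _ ≤ lam * (K * M i) := mul_le_mul_of_nonneg_left (hb i) hlam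
      _ = _ := by ring
  have e := bexp_exp_sum_ipw_le (T := T) (s := T) subset_rfl (b := fun i => lam * b i) (p := p)
    (r := condProb p A) (v := fun i => K ^ 2 * lam * τ * M i) hp (condProb_nonneg hp A)
    (condProb_le_one hp1 A) (fun i _ => by have := hM i; positivity)
    (fun i _ => (hvar i).imp_right fun h => ⟨(hbp i).trans h.1, le_trans
      (mul_le_mul_of_nonneg_left (pow_le_pow_left₀ (by have := hp i; positivity) (hbp i) 2)
        (condProb_nonneg hp A i)) h.2⟩)
  simp only [mul_assoc lam, ← mul_sum] at e
  refine e.trans (Real.exp_le_exp.2 (add_le_add ?_ ?_))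
  · have h1 : ∀ i, lam * (b i * (condProb p A i / p i)) ≤ lam * b i + if i ∈ A then 1 else 0 := by
      intro i
      have h2 := mul_le_mul_of_nonneg_right ((le_abs_self _).trans (hb i))
        (bias_nonneg hp hp1 A i)
      have h3 := mul_bias_le hp A hlam hτ hM hpM i
      have h4 : K * (lam * M i * (condProb p A i / p i - 1)) ≤ if i ∈ A then 1 else 0 := by
        refine (mul_le_mul_of_nonneg_left h3 hK).trans ?_
        split_ifs
        · exact hKτ
        · simp
      nlinarith
    rw [mul_sum, mul_sum]
    refine (sum_le_sum fun i _ => h1 i).trans ?_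
    rw [sum_add_distrib]
    gcongr
    rw [sum_ite_mem, sum_const, nsmul_eq_mul, mul_one]
    exact_mod_cast card_le_card inter_subset_right
  · exact mul_le_mul_of_nonneg_left
      (sum_le_sum_of_subset_of_nonneg (subset_univ T) fun i _ _ => hM i) (by positivity)

end

end Linear

/-! ### Decoupling of the quadratic error -/

section Quadratic

variable {V : Type*} [Fintype V] [DecidableEq V] (G : SimpleGraph V) [DecidableRel G.Adj]

/-- The part of the sampling error at the vertex `i` that comes from the neighbours outside `T`. -/
noncomputable def outerError (p c : V → ℝ) (T U : Finset V) (i : V) : ℝ :=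
  ∑ j ∈ nbrs G univ i \ T, c j * (ipw p U j - 1)

theorem outerError_eq (p c : V → ℝ) (T U : Finset V) (i : V) :
    outerError G p c T U i =
      ∑ j ∈ nbrs G univ i, c j * (ipw p U j - 1) * (1 - if j ∈ T then 1 else 0) := by
  rw [outerError, ← filter_notMem_eq_sdiff, sum_filter]
  exact sum_congr rfl fun j _ => by split_ifs <;> simp_all

/-- A uniformly random `T` separates `i` from a given neighbour (`i ∈ T`, `j ∉ T`) with probability
`1 / 4`, so that the error at `i` is bounded by four times the average of its decoupled parts. -/
theorem abs_nbrError_le (p c : V → ℝ) (U : Finset V) (i : V) :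
    |nbrError G p c U i| ≤ 4 * bexp univ (fun _ => 1 / 2)
      (fun T => (if i ∈ T then 1 else 0) * |outerError G p c T U i|) := by
  have h : nbrError G p c U i = 4 * bexp univ (fun _ => 1 / 2)
      (fun T => (if i ∈ T then 1 else 0) * outerError G p c T U i) := by
    have e : ∀ T : Finset V, (if i ∈ T then (1 : ℝ) else 0) * outerError G p c T U i =
        ∑ j ∈ nbrs G univ i, c j * (ipw p U j - 1) *
          ((if {i} ⊆ T then 1 else 0) + (-1) * if {i, j} ⊆ T then 1 else 0) := by
      intro T
      rw [outerError_eq, mul_sum]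
      refine sum_congr rfl fun j _ => ?_
      by_cases hi : i ∈ T <;> by_cases hj : j ∈ T <;> simp [insert_subset_iff, hi, hj]
    simp only [e]
    rw [bexp_sum, nbrError, mul_sum]
    refine sum_congr rfl fun j hj => ?_
    have hij : i ≠ j := by
      simp only [nbrs, mem_filter, mem_univ, true_and] at hj
      exact hj.ne
    rw [bexp_const_mul, bexp_add, bexp_const_mul, bexp_superset (subset_univ _),
      bexp_superset (subset_univ _), prod_singleton, prod_pair hij]
    ring
  have hle : ∀ σ : ℝ, |σ| = 1 → σ * nbrError G p c U i ≤ 4 * bexp univ (fun _ => 1 / 2)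
      (fun T => (if i ∈ T then 1 else 0) * |outerError G p c T U i|) := by
    intro σ hσ
    rw [h, mul_left_comm, ← bexp_const_mul]
    refine mul_le_mul_of_nonneg_left (bexp_mono (by norm_num) (by norm_num) fun T _ => ?_)
      (by norm_num)
    rw [mul_left_comm]
    refine mul_le_mul_of_nonneg_left ?_ (by split_ifs <;> simp)
    refine (le_abs_self _).trans_eq ?_
    rw [abs_mul, hσ, one_mul]
  rw [abs_le']
  exact ⟨by simpa using hle 1 (by simp), by simpa using hle (-1) (by simp)⟩

/-- The decoupled quadratic error: the weights `ξ_i` are taken on `T` and the errors, truncated at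
`8 M_i`, outside `T`. -/
noncomputable def decoupledError (p c M : V → ℝ) (T U : Finset V) : ℝ :=
  ∑ i ∈ T, min |outerError G p c T U i| (8 * M i) * ipw p U i

theorem sum_ipw_mul_abs_nbrError_le {p c M : V → ℝ} (hp : ∀ i, 0 < p i) (hc0 : ∀ i, 0 ≤ c i)
    (hc2 : ∀ i, c i ≤ 2) (hM : ∀ i, (G.degree i : ℝ) ≤ M i) {U : Finset V}
    (hU : ∀ i, ∑ j ∈ nbrs G univ i, ipw p U j ≤ 3 * M i) :
    ∑ i, ipw p U i * |nbrError G p c U i| ≤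
      bexp univ (fun _ => 1 / 2) (fun T => 4 * decoupledError G p c M T U) := by
  have hout : ∀ T i, |outerError G p c T U i| ≤ 8 * M i := by
    intro T i
    calc _ ≤ ∑ j ∈ nbrs G univ i \ T, |c j * (ipw p U j - 1)| := abs_sum_le_sum_abs _ _
      _ ≤ ∑ j ∈ nbrs G univ i \ T, (2 * ipw p U j + 2) := by
        refine sum_le_sum fun j _ => ?_
        have h0 := ipw_nonneg hp U j
        rw [abs_mul, abs_of_nonneg (hc0 j)]
        have h1 : |ipw p U j - 1| ≤ ipw p U j + 1 := abs_le.2 ⟨by linarith, by linarith⟩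
        have := mul_le_mul (hc2 j) h1 (abs_nonneg _) zero_le_two
        linarith
      _ ≤ ∑ j ∈ nbrs G univ i, (2 * ipw p U j + 2) :=
        sum_le_sum_of_subset_of_nonneg sdiff_subset fun j _ _ => by
          have h0 := ipw_nonneg hp U j
          linarith
      _ ≤ _ := by
        rw [sum_add_distrib, ← mul_sum, sum_const, nsmul_eq_mul, card_nbrs_univ]
        linarith [hU i, hM i]
  calc _ ≤ ∑ i, ipw p U i * (4 * bexp univ (fun _ => 1 / 2)
        (fun T => (if i ∈ T then 1 else 0) * |outerError G p c T U i|)) :=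
        sum_le_sum fun i _ => mul_le_mul_of_nonneg_left (abs_nbrError_le G p c U i)
          (ipw_nonneg hp U i)
    _ = bexp univ (fun _ => 1 / 2) (fun T => ∑ i, ipw p U i * (4 *
          ((if i ∈ T then 1 else 0) * |outerError G p c T U i|))) := by
        rw [bexp_sum]
        exact sum_congr rfl fun i _ => by rw [bexp_const_mul, bexp_const_mul]
    _ = _ := by
        refine bexp_congr fun T _ => ?_
        rw [decoupledError, mul_sum, ← sum_subset (subset_univ T)]
        · refine sum_congr rfl fun i hi => ?_
          rw [if_pos hi, min_eq_left (hout T i)]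
          ring
        · intro i _ hi
          rw [if_neg hi]
          ring

variable {p : V → ℝ} (hp : ∀ i, 0 < p i) (hp1 : ∀ i, p i ≤ 1) (A : Finset V)
  {c : V → ℝ} (hc0 : ∀ i, 0 ≤ c i) (hc2 : ∀ i, c i ≤ 2)
include hp hc0 hc2

omit hc0 hc2 in
theorem outerError_insert_sub (c : V → ℝ) (T U : Finset V) (i j : V) :
    |outerError G p c T (insert j U) i - outerError G p c T U i| ≤
      if j ∈ nbrs G univ i \ T then |c j| / p j else 0 := by
  refine le_trans (le_of_eq ?_) (abs_sum_ipw_insert_sub hp (nbrs G univ i \ T) c j U)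
  simp only [outerError, mul_sub, sum_sub_distrib]
  congr 1
  ring

theorem abs_outerError_insert_sub_le (T U : Finset V) (i j : V) :
    |outerError G p c T (insert j U) i - outerError G p c T U i| ≤
      if j ∈ nbrs G univ i then 2 / p j else 0 := by
  refine (outerError_insert_sub G hp c T U i j).trans ?_
  have hpj := hp j
  by_cases hj : j ∈ nbrs G univ i
  · rw [if_pos hj]
    split_ifs
    · rw [abs_of_nonneg (hc0 j)]
      exact div_le_div_of_nonneg_right (hc2 j) hpj.le
    · positivity
  · rw [if_neg hj, if_neg fun h => hj (mem_sdiff.1 h).1]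

include hp1 in
/-- The mean absolute value of the error at one vertex. The scale `s` is the inverse of the allowed
error; the last sum is the bias due to the vertices of `A`. -/
theorem bexp_abs_outerError_le (T : Finset V) {s : ℝ} (hs : 0 < s) (i : V)
    (h : ∀ j, p j = 1 ∨ (2 * s ≤ p j ∧ 4 * s ^ 2 * G.degree i ≤ p j)) :
    bexp Tᶜ (condProb p A) (fun U => |outerError G p c T U i|) ≤
      6 / s + ∑ j ∈ nbrs G univ i, 2 * (condProb p A j / p j - 1) := by
  have h0 := condProb_nonneg hp A
  have h1 := condProb_le_one hp1 A
  set m := bexp Tᶜ (condProb p A) (fun U => outerError G p c T U i) with hm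
  have hsub : nbrs G univ i \ T ⊆ Tᶜ := fun j hj => mem_compl.2 (mem_sdiff.1 hj).2
  have hm_eq : m = ∑ j ∈ nbrs G univ i \ T, c j * (condProb p A j / p j - 1) := by
    simp only [hm, outerError, mul_sub, mul_one, sum_sub_distrib]
    simp only [sub_eq_add_neg]
    rw [bexp_add, bexp_const, bexp_sum_ipw hsub]
  have hb := bias_nonneg hp hp1 A
  have hm0 : 0 ≤ m := hm_eq ▸ sum_nonneg fun j _ => mul_nonneg (hc0 j) (hb j)
  have hm1 : m ≤ ∑ j ∈ nbrs G univ i, 2 * (condProb p A j / p j - 1) := by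
    rw [hm_eq]
    refine (sum_le_sum fun j _ => mul_le_mul_of_nonneg_right (hc2 j) (hb j)).trans ?_
    exact sum_le_sum_of_subset_of_nonneg sdiff_subset fun j _ _ => by linarith [hb j]
  have hdev := bexp_abs_sub_le (T := Tᶜ) (r := condProb p A)
    (δ := fun j => if j ∈ nbrs G univ i then 2 / p j else 0)
    (v := fun j => if j ∈ nbrs G univ i then 1 / (G.degree i : ℝ) else 0) hs
    (fun j _ => h0 j) (fun j _ => h1 j) (fun j _ => by split_ifs <;> positivity)
    (fun j _ => by
      by_cases hj : j ∈ nbrs G univ i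
      · simp only [if_pos hj]
        unfold condProb
        split_ifs
        · exact Or.inl rfl
        refine (h j).imp_right fun ⟨ha, hb⟩ => ?_
        have hpj := hp j
        have hd : (0 : ℝ) < G.degree i := by
          rw [← card_nbrs_univ]
          exact_mod_cast card_pos.2 ⟨j, hj⟩
        constructor
        · rw [← mul_div_assoc, div_le_one hpj]
          linarith
        · rw [le_div_iff₀ hd]
          calc p j * (s * (2 / p j)) ^ 2 * G.degree i = 4 * s ^ 2 * G.degree i / p j := by
                field_simp; ring
            _ ≤ 1 := (div_le_one hpj).2 hb
      · right; simp [hj])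
    (by
      rw [sum_ite_mem, sum_const, nsmul_eq_mul, mul_one_div]
      refine div_le_one_of_le₀ ?_ (Nat.cast_nonneg _)
      rw [← card_nbrs_univ]
      exact_mod_cast card_le_card inter_subset_right)
    (fun U => outerError G p c T U i)
    (fun j _ U _ => abs_outerError_insert_sub_le G hp hc0 hc2 T U i j)
  have htri : bexp Tᶜ (condProb p A) (fun U => |outerError G p c T U i|) ≤
      bexp Tᶜ (condProb p A) (fun U => |outerError G p c T U i - m| + m) := by
    refine bexp_mono (fun j _ => h0 j) (fun j _ => h1 j) fun U _ => ?_
    have := abs_sub_abs_le_abs_sub (outerError G p c T U i) m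
    rw [abs_of_nonneg hm0] at this
    linarith
  rw [bexp_add, bexp_const] at htri
  linarith

-- `lam` is the parameter of the exponential moments; the last hypothesis says that the importance
-- sampling bounds the influence `lam * M i / p i` of every vertex that is not always sampled.
variable {lam τ : ℝ} {M : V → ℝ} (hlam : 0 ≤ lam) (hτ : 0 ≤ τ) (hτ1 : 32 * τ ≤ 1)
  (hM : ∀ i, (G.degree i : ℝ) ≤ M i)
  (hpM : ∀ i, p i = 1 ∨ lam * M i ≤ τ * p i)
include hp1 hlam hτ hτ1 hM hpM

/-- The exponential moment of the summed errors, which are functions of the choices outside `T`. -/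
theorem bexp_exp_outerError_le (T : Finset V) {s : V → ℝ} (hs : ∀ i, 0 < s i)
    (h : ∀ i j, p j = 1 ∨ (2 * s i ≤ p j ∧ 4 * s i ^ 2 * G.degree i ≤ p j)) :
    bexp Tᶜ (condProb p A) (fun U => Real.exp
        (lam * ∑ i ∈ T, 4 * min |outerError G p c T U i| (8 * M i))) ≤
      Real.exp (24 * lam * ∑ i, 1 / s i + A.card + 64 * lam * τ * ∑ i, M i) := by
  have h0 := condProb_nonneg hp A
  have h1 := condProb_le_one hp1 A
  have hM0 : ∀ i, 0 ≤ M i := fun i => (Nat.cast_nonneg _).trans (hM i)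
  have hb := bias_nonneg hp hp1 A
  have hcard : ∀ f : V → ℝ, ∑ i, ∑ j ∈ nbrs G univ i, f j = ∑ j, G.degree j * f j := by
    intro f
    rw [sum_nbrs_comm]
    exact sum_congr rfl fun i _ => by rw [sum_const, nsmul_eq_mul, card_nbrs_univ]
  have hcard' : ∀ (f : V → ℝ) (j : V), ∑ i, (if j ∈ nbrs G univ i then f j else 0) =
      G.degree j * f j := by
    intro f j
    rw [← card_nbrs_univ, ← nsmul_eq_mul, ← sum_const, nbrs, sum_filter]
    simp only [nbrs, mem_filter, mem_univ, true_and, G.adj_comm]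
  have hvar := variance_le hp A hlam hM0 hpM (K := 8) (by norm_num) (by linarith)
  have e := bexp_exp_le (T := Tᶜ) (r := condProb p A) (δ := fun j => 8 * lam * M j / p j)
    (v := fun j => 8 ^ 2 * lam * τ * M j) (fun j _ => h0 j) (fun j _ => h1 j)
    (fun j _ => by have := hM0 j; positivity) (fun j _ => hvar j)
    (fun U => lam * ∑ i ∈ T, 4 * min |outerError G p c T U i| (8 * M i))
    (fun j _ U _ => by
      have hpj := hp j
      rw [← mul_sub, ← sum_sub_distrib, abs_mul, abs_of_nonneg hlam]
      have hstep : |∑ i ∈ T, (4 * min |outerError G p c T (insert j U) i| (8 * M i) -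
          4 * min |outerError G p c T U i| (8 * M i))| ≤ 4 * (G.degree j * (2 / p j)) := by
        refine (abs_sum_le_sum_abs _ _).trans ?_
        refine (sum_le_sum_of_subset_of_nonneg (subset_univ T) fun i _ _ => abs_nonneg _).trans ?_
        rw [← hcard' (fun j => 2 / p j) j, mul_sum]
        refine sum_le_sum fun i _ => ?_
        rw [← mul_sub, abs_mul, abs_of_pos (four_pos)]
        refine mul_le_mul_of_nonneg_left ?_ (by norm_num)
        refine le_trans ?_ (abs_outerError_insert_sub_le G hp hc0 hc2 T U i j)
        refine (abs_min_sub_min_le_max _ _ _ _).trans ?_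
        rw [sub_self, abs_zero, max_eq_left (abs_nonneg _)]
        exact abs_abs_sub_abs_le_abs_sub _ _
      calc _ ≤ lam * (4 * (G.degree j * (2 / p j))) := mul_le_mul_of_nonneg_left hstep hlam
        _ = 8 * lam * G.degree j / p j := by ring
        _ ≤ _ := by have := hM j; gcongr)
  refine e.trans (Real.exp_le_exp.2 (add_le_add ?_ ?_))
  · rw [bexp_const_mul, bexp_sum]
    have hi : ∀ i, bexp Tᶜ (condProb p A)
        (fun U => 4 * min |outerError G p c T U i| (8 * M i)) ≤
        4 * (6 / s i + ∑ j ∈ nbrs G univ i, 2 * (condProb p A j / p j - 1)) := by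
      intro i
      rw [bexp_const_mul]
      refine mul_le_mul_of_nonneg_left ?_ (by norm_num)
      refine le_trans (bexp_mono (fun j _ => h0 j) (fun j _ => h1 j) fun U _ => min_le_left _ _)
        (bexp_abs_outerError_le G hp hp1 A hc0 hc2 T (hs i) i (h i))
    have hnn : ∀ i, 0 ≤ 4 * (6 / s i + ∑ j ∈ nbrs G univ i, 2 * (condProb p A j / p j - 1)) :=
      fun i => by
        have := sum_nonneg fun j (_ : j ∈ nbrs G univ i) => mul_nonneg zero_le_two (hb j)
        have := hs i
        positivity
    have hA : lam * ∑ j, G.degree j * (8 * (condProb p A j / p j - 1)) ≤ A.card := by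
      rw [mul_sum]
      calc _ ≤ ∑ j, if j ∈ A then (1 : ℝ) else 0 := by
            refine sum_le_sum fun j _ => ?_
            have h3 := mul_bias_le hp A hlam hτ hM0 hpM j
            have h4 : lam * G.degree j * (condProb p A j / p j - 1) ≤
                lam * M j * (condProb p A j / p j - 1) :=
              mul_le_mul_of_nonneg_right (mul_le_mul_of_nonneg_left (hM j) hlam) (hb j)
            split_ifs at h3 ⊢ <;> linarith
        _ = _ := by simp
    calc _ ≤ lam * ∑ i, 4 * (6 / s i + ∑ j ∈ nbrs G univ i, 2 * (condProb p A j / p j - 1)) := by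
          refine mul_le_mul_of_nonneg_left ?_ hlam
          exact (sum_le_sum fun i _ => hi i).trans
            (sum_le_sum_of_subset_of_nonneg (subset_univ T) fun i _ _ => hnn i)
      _ = 24 * lam * ∑ i, 1 / s i + lam * ∑ j, G.degree j * (8 * (condProb p A j / p j - 1)) := by
          rw [← mul_sum, sum_add_distrib, hcard]
          have e1 : ∑ i, 6 / s i = 6 * ∑ i, 1 / s i := by
            rw [mul_sum]; exact sum_congr rfl fun i _ => by ring
          have e2 : ∑ j, (G.degree j : ℝ) * (8 * (condProb p A j / p j - 1)) =
              4 * ∑ j, G.degree j * (2 * (condProb p A j / p j - 1)) := by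
            rw [mul_sum]; exact sum_congr rfl fun i _ => by ring
          rw [e1, e2]; ring
      _ ≤ _ := by linarith
  · rw [← mul_sum]
    have := sum_le_sum_of_subset_of_nonneg (subset_univ Tᶜ) fun i _ _ => hM0 i
    have h3 : (8 : ℝ) ^ 2 * lam * τ = 64 * lam * τ := by ring
    rw [h3]
    exact mul_le_mul_of_nonneg_left this (by positivity)

/-- The exponential moment of the decoupled error: first over the choices in `T`, for which it is a
weighted sum with bounded coefficients, then over the choices outside `T`. -/
theorem bexp_exp_decoupledError_le (T : Finset V) {s : V → ℝ} (hs : ∀ i, 0 < s i)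
    (h : ∀ i j, p j = 1 ∨ (2 * s i ≤ p j ∧ 4 * s i ^ 2 * G.degree i ≤ p j)) :
    bexp univ (condProb p A) (fun U => Real.exp (lam * (4 * decoupledError G p c M T U))) ≤
      Real.exp (24 * lam * ∑ i, 1 / s i + 2 * A.card + 1088 * lam * τ * ∑ i, M i) := by
  have h0 := condProb_nonneg hp A
  have h1 := condProb_le_one hp1 A
  have hM0 : ∀ i, 0 ≤ M i := fun i => (Nat.cast_nonneg _).trans (hM i)
  have huniv : ∀ F : Finset V → ℝ, bexp univ (condProb p A) F =
      bexp Tᶜ (condProb p A) (fun U' => bexp T (condProb p A) (fun U => F (U ∪ U'))) := fun F => by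
    rw [← bexp_union disjoint_compl_right, union_compl]
  rw [huniv]
  -- For fixed choices outside `T` the decoupled error is a weighted sum of the choices in `T`.
  have hsplit : ∀ U ⊆ T, ∀ U' ⊆ Tᶜ, 4 * decoupledError G p c M T (U ∪ U') =
      ∑ i ∈ T, 4 * min |outerError G p c T U' i| (8 * M i) * ipw p U i := by
    intro U hU U' hU'
    rw [decoupledError, mul_sum]
    refine sum_congr rfl fun i hi => ?_
    have e1 : outerError G p c T (U ∪ U') i = outerError G p c T U' i := by
      refine sum_congr rfl fun j hj => ?_
      have hjU : j ∉ U := fun h => (mem_sdiff.1 hj).2 (hU h)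
      simp [ipw, hjU]
    have e2 : ipw p (U ∪ U') i = ipw p U i := by
      have hiU : i ∉ U' := fun h => mem_compl.1 (hU' h) hi
      simp [ipw, hiU]
    rw [e1, e2, mul_assoc]
  have hin : ∀ U' ⊆ Tᶜ, bexp T (condProb p A) (fun U => Real.exp
      (lam * (4 * decoupledError G p c M T (U ∪ U')))) ≤
      Real.exp (A.card + 1024 * lam * τ * ∑ i, M i) * Real.exp
        (lam * ∑ i ∈ T, 4 * min |outerError G p c T U' i| (8 * M i)) := by
    intro U' hU'
    rw [bexp_congr fun U hU => by rw [hsplit U hU U' hU']]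
    have e := bexp_exp_linear_le hp hp1 A hlam hτ hM0 hpM T (K := 32) (by norm_num) hτ1
      (b := fun i => 4 * min |outerError G p c T U' i| (8 * M i)) (fun i => by
        have h8 : 0 ≤ 8 * M i := by linarith [hM0 i]
        rw [abs_of_nonneg (mul_nonneg zero_le_four (le_min (abs_nonneg _) h8))]
        linarith [min_le_right |outerError G p c T U' i| (8 * M i)])
    refine e.trans_eq ?_
    rw [← Real.exp_add]
    congr 1
    ring
  refine (bexp_mono (fun j _ => h0 j) (fun j _ => h1 j) hin).trans ?_
  rw [bexp_const_mul]
  refine (mul_le_mul_of_nonneg_left (bexp_exp_outerError_le G hp hp1 A hc0 hc2 hlam hτ hτ1 hM hpM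
    T hs h) (Real.exp_pos _).le).trans_eq ?_
  rw [← Real.exp_add]
  congr 1
  ring

open Classical in
/-- For a fixed `A`, and away from samples with an atypically large weighted degree, the empirical
dual value exceeds the dual value by `2 t` with exponentially small probability. -/
theorem prob_deviation_le {s : V → ℝ} (hs : ∀ i, 0 < s i)
    (h : ∀ i j, p j = 1 ∨ (2 * s i ≤ p j ∧ 4 * s i ^ 2 * G.degree i ≤ p j))
    {f : V → ℝ} (hf : ∀ i, |f i| ≤ 5 * M i) (t : ℝ) :
    bexp univ (condProb p A) (fun U => if (∀ i, ∑ j ∈ nbrs G univ i, ipw p U j ≤ 3 * M i) ∧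
        ∑ i, f i + 2 * t <
          ∑ i, f i * ipw p U i + ∑ i, ipw p U i * |nbrError G p c U i| then 1 else 0) ≤
      2 * Real.exp (24 * lam * ∑ i, 1 / s i + 2 * A.card + 1088 * lam * τ * ∑ i, M i
        - lam * t) := by
  have h0 := condProb_nonneg hp A
  have h1 := condProb_le_one hp1 A
  have hM0 : ∀ i, 0 ≤ M i := fun i => (Nat.cast_nonneg _).trans (hM i)
  have hlin := bexp_exp_linear_le hp hp1 A hlam hτ hM0 hpM univ (K := 5) (by norm_num)
    (by linarith) hf
  have hquad : bexp univ (condProb p A) (fun U => bexp univ (fun _ => 1 / 2) (fun T =>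
      Real.exp (lam * (4 * decoupledError G p c M T U)))) ≤
      Real.exp (24 * lam * ∑ i, 1 / s i + 2 * A.card + 1088 * lam * τ * ∑ i, M i) := by
    rw [bexp_comm]
    refine (bexp_mono (by norm_num) (by norm_num) fun T _ => bexp_exp_decoupledError_le G hp hp1 A
      hc0 hc2 hlam hτ hτ1 hM hpM T hs h).trans_eq (bexp_const _ _ _)
  have hmk : bexp univ (condProb p A) (fun U =>
      if (∀ i, ∑ j ∈ nbrs G univ i, ipw p U j ≤ 3 * M i) ∧ ∑ i, f i + 2 * t <
        ∑ i, f i * ipw p U i + ∑ i, ipw p U i * |nbrError G p c U i| then 1 else 0) ≤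
      bexp univ (condProb p A) (fun U =>
        Real.exp (-(lam * (∑ i, f i + t))) * Real.exp (lam * ∑ i, f i * ipw p U i) +
        Real.exp (-(lam * t)) * bexp univ (fun _ => 1 / 2) (fun T =>
          Real.exp (lam * (4 * decoupledError G p c M T U)))) := by
    refine bexp_mono (fun j _ => h0 j) (fun j _ => h1 j) fun U _ => ?_
    have p2 : 0 ≤ bexp univ (fun _ : V => (1 : ℝ) / 2) (fun T =>
        Real.exp (lam * (4 * decoupledError G p c M T U))) :=
      bexp_nonneg (by norm_num) (by norm_num) fun T => (Real.exp_pos _).le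
    split_ifs with hbad
    -- Either the linear part or the quadratic part exceeds its mean by `t`.
    · obtain ⟨hD, hlt⟩ := hbad
      rw [← Real.exp_add]
      by_cases hl : ∑ i, f i + t ≤ ∑ i, f i * ipw p U i
      · have h3 : 1 ≤ Real.exp (-(lam * (∑ i, f i + t)) + lam * ∑ i, f i * ipw p U i) :=
          Real.one_le_exp (by nlinarith)
        have := mul_nonneg (Real.exp_pos (-(lam * t))).le p2
        linarith
      · have h4 := sum_ipw_mul_abs_nbrError_le G hp hc0 hc2 hM hD
        have h5 : t ≤ bexp univ (fun _ => 1 / 2) (fun T => 4 * decoupledError G p c M T U) := by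
          linarith [not_le.1 hl]
        have h6 := exp_bexp_le (T := univ) (r := fun _ : V => (1 : ℝ) / 2) (by norm_num)
          (by norm_num) (fun T => lam * (4 * decoupledError G p c M T U))
        rw [bexp_const_mul] at h6
        have h7 := mul_le_mul_of_nonneg_left h6 (Real.exp_pos (-(lam * t))).le
        rw [← Real.exp_add] at h7
        have h8 : 1 ≤ Real.exp (-(lam * t) +
            lam * bexp univ (fun _ => 1 / 2) (fun T => 4 * decoupledError G p c M T U)) :=
          Real.one_le_exp (by nlinarith)
        have := Real.exp_pos (-(lam * (∑ i, f i + t)) + lam * ∑ i, f i * ipw p U i)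
        linarith
    · positivity
  refine hmk.trans ?_
  rw [bexp_add, bexp_const_mul, bexp_const_mul]
  have k1 := mul_le_mul_of_nonneg_left hlin (Real.exp_pos (-(lam * (∑ i, f i + t)))).le
  have k2 := mul_le_mul_of_nonneg_left hquad (Real.exp_pos (-(lam * t))).le
  rw [← Real.exp_add] at k1 k2
  have k3 : -(lam * (∑ i, f i + t)) + (lam * ∑ i, f i + A.card + 5 ^ 2 * lam * τ * ∑ i, M i) ≤
      24 * lam * ∑ i, 1 / s i + 2 * A.card + 1088 * lam * τ * ∑ i, M i - lam * t := by
    have a1 : 0 ≤ lam * ∑ i, 1 / s i :=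
      mul_nonneg hlam (sum_nonneg fun i _ => (one_div_pos.2 (hs i)).le)
    have a2 : 0 ≤ lam * τ * ∑ i, M i :=
      mul_nonneg (mul_nonneg hlam hτ) (sum_nonneg fun i _ => hM0 i)
    have a3 : (0 : ℝ) ≤ A.card := Nat.cast_nonneg _
    linarith
  have k4 : -(lam * t) + (24 * lam * ∑ i, 1 / s i + 2 * A.card + 1088 * lam * τ * ∑ i, M i) =
      24 * lam * ∑ i, 1 / s i + 2 * A.card + 1088 * lam * τ * ∑ i, M i - lam * t := by ring
  rw [k4] at k2
  exact (add_le_add (k1.trans (Real.exp_le_exp.2 k3)) k2).trans_eq (two_mul _).symm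

end Quadratic

/-! ### The union bound over the sides of the partition -/

section UnionBound

variable {V : Type*} [Fintype V] [DecidableEq V]

/-- The expectation of `F S S'` under double sampling. -/
noncomputable def dexp (p : V → ℝ) (q : ℝ) (F : Finset V → Finset V → ℝ) : ℝ :=
  bexp univ p (fun S' => bexp S' (fun v => q / p v) (fun S => F S S'))

open Classical in
theorem doubleSampleProb_eq_dexp (p : V → ℝ) (q : ℝ) (E : Finset V → Finset V → Prop) :
    doubleSampleProb p (fun _ => q) E = dexp p q (fun S S' => if E S S' then 1 else 0) := by
  unfold doubleSampleProb dexp bexp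
  rw [powerset_univ]
  refine sum_congr rfl fun S' _ => ?_
  rw [mul_sum]
  exact sum_congr rfl fun S _ => by by_cases h : E S S' <;> simp [h]

theorem dexp_const (p : V → ℝ) (q c : ℝ) : dexp p q (fun _ _ => c) = c := by
  simp only [dexp, bexp_const]

theorem dexp_add (p : V → ℝ) (q : ℝ) (F F' : Finset V → Finset V → ℝ) :
    dexp p q (fun S S' => F S S' + F' S S') = dexp p q F + dexp p q F' := by
  simp only [dexp, bexp_add]

theorem dexp_sum {ι : Type*} (p : V → ℝ) (q : ℝ) (s : Finset ι)
    (F : ι → Finset V → Finset V → ℝ) :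
    dexp p q (fun S S' => ∑ i ∈ s, F i S S') = ∑ i ∈ s, dexp p q (F i) := by
  simp only [dexp, bexp_sum]

theorem dexp_const_mul (p : V → ℝ) (q c : ℝ) (F : Finset V → Finset V → ℝ) :
    dexp p q (fun S S' => c * F S S') = c * dexp p q F := by
  simp only [dexp, bexp_const_mul]

theorem dexp_sample (p : V → ℝ) (q : ℝ) (F : Finset V → ℝ) :
    dexp p q (fun _ S' => F S') = bexp univ p F := by
  simp only [dexp, bexp_const]

theorem dexp_mono {p : V → ℝ} {q : ℝ} (hp : ∀ i, 0 < p i) (hp1 : ∀ i, p i ≤ 1) (hq : 0 ≤ q)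
    (hqp : ∀ i, q ≤ p i) {F F' : Finset V → Finset V → ℝ}
    (h : ∀ S S', S ⊆ S' → F S S' ≤ F' S S') : dexp p q F ≤ dexp p q F' :=
  bexp_mono (fun v _ => (hp v).le) (fun v _ => hp1 v) fun S' _ =>
    bexp_mono (fun v _ => div_nonneg hq (hp v).le) (fun v _ => (div_le_one (hp v)).2 (hqp v))
      fun S hS => h S S' hS

theorem subsetProb_condProb {p : V → ℝ} (hp : ∀ i, 0 < p i) (A U : Finset V) :
    subsetProb univ (condProb p A) U =
      if A ⊆ U then subsetProb univ p U * ∏ v ∈ A, 1 / p v else 0 := by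
  split_ifs with hA
  · have h1 : ∏ v ∈ U, p v = (∏ v ∈ A, p v) * ∏ v ∈ U, condProb p A v := by
      rw [← prod_sdiff hA, ← prod_sdiff hA (f := condProb p A)]
      have e1 : ∏ v ∈ U \ A, condProb p A v = ∏ v ∈ U \ A, p v :=
        prod_congr rfl fun v hv => if_neg (mem_sdiff.1 hv).2
      have e2 : ∏ v ∈ A, condProb p A v = 1 := prod_eq_one fun v hv => if_pos hv
      rw [e1, e2]; ring
    have h2 : ∏ v ∈ univ \ U, (1 - condProb p A v) = ∏ v ∈ univ \ U, (1 - p v) :=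
      prod_congr rfl fun v hv => by rw [condProb, if_neg fun h => (mem_sdiff.1 hv).2 (hA h)]
    have h3 : (∏ v ∈ A, p v) * ∏ v ∈ A, 1 / p v = 1 := by
      rw [← prod_mul_distrib]
      exact prod_eq_one fun v _ => mul_one_div_cancel (hp v).ne'
    rw [subsetProb, subsetProb, h1, h2]
    linear_combination (-((∏ v ∈ U, condProb p A v) * ∏ v ∈ univ \ U, (1 - p v))) * h3
  · obtain ⟨a, ha, haU⟩ := not_subset.1 hA
    rw [subsetProb, prod_eq_zero (i := a) (s := univ \ U) (by simp [haU]) (by simp [condProb, ha]),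
      mul_zero]

/-- The event `A ⊆ S` has probability `q ^ |A|`, and conditioning on it changes the law of `S'` only
by forcing the vertices of `A` into `S'`. -/
theorem dexp_superset {p : V → ℝ} (hp : ∀ i, 0 < p i) (q : ℝ) (A : Finset V)
    (Q : Finset V → ℝ) :
    dexp p q (fun S S' => Q S' * if A ⊆ S then 1 else 0) =
      q ^ A.card * bexp univ (condProb p A) Q := by
  unfold dexp
  simp only [bexp_const_mul]
  rw [bexp, bexp, mul_sum]
  refine sum_congr rfl fun S' _ => ?_
  rw [subsetProb_condProb hp]
  split_ifs with hA
  · rw [bexp_superset hA]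
    have : ∏ v ∈ A, q / p v = q ^ A.card * ∏ v ∈ A, 1 / p v := by
      rw [← prod_const, ← prod_mul_distrib]
      exact prod_congr rfl fun v _ => by ring
    rw [this]; ring
  · have : bexp S' (fun v => q / p v) (fun S => if A ⊆ S then (1 : ℝ) else 0) =
        bexp S' (fun v => q / p v) (fun _ => 0) :=
      bexp_congr fun S hS => if_neg fun h => hA (h.trans hS)
    rw [this, bexp_const]; ring

omit [Fintype V] [DecidableEq V] in
theorem sum_pow_card_powerset (T : Finset V) (x : ℝ) :
    ∑ A ∈ T.powerset, x ^ A.card = (1 + x) ^ T.card := by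
  have := sum_pow_mul_eq_add_pow x 1 T
  simpa [add_comm] using this

theorem one_add_pow_le_exp {x : ℝ} (hx : 0 ≤ x) (k : ℕ) : (1 + x) ^ k ≤ Real.exp (x * k) := by
  rw [mul_comm, Real.exp_nat_mul]
  exact pow_le_pow_left₀ (by linarith) (by linarith [Real.add_one_le_exp x]) k

variable (G : SimpleGraph V) [DecidableRel G.Adj]

theorem guess_eq (q : ℝ) (A : Finset V) (i : V) :
    guess G q A i = (nbrs G univ i ∩ A).card / q := by
  rw [guess, rho, sum_const, nsmul_eq_mul, mul_one_div]

theorem guess_mono {q : ℝ} (hq : 0 < q) {A S : Finset V} (h : A ⊆ S) (i : V) :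
    guess G q A i ≤ guess G q S i := by
  rw [guess_eq, guess_eq]
  gcongr

variable {p : V → ℝ} {q : ℝ} {M : V → ℝ}

open Classical in
/-- Markov's inequality for `2 ^ |S ∩ Γ(i)|`, the number of subsets of `S ∩ Γ(i)`. -/
theorem prob_guess_gt_le (hp : ∀ i, 0 < p i) (hp1 : ∀ i, p i ≤ 1) (hq : 0 < q)
    (hqp : ∀ i, q ≤ p i) (hM : ∀ i, (G.degree i : ℝ) ≤ M i) (i : V) :
    dexp p q (fun S _ => if 3 * M i < guess G q S i then 1 else 0) ≤
      Real.exp (-(q * M i)) := by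
  have hM0 : 0 ≤ M i := (Nat.cast_nonneg _).trans (hM i)
  calc _ ≤ dexp p q (fun S _ => Real.exp (-(2 * (q * M i))) *
        ∑ A ∈ (nbrs G univ i).powerset, 1 * if A ⊆ S then 1 else 0) := by
        refine dexp_mono hp hp1 hq.le hqp fun S _ _ => ?_
        have e : ∑ A ∈ (nbrs G univ i).powerset, 1 * (if A ⊆ S then (1 : ℝ) else 0) =
            2 ^ (nbrs G univ i ∩ S).card := by
          have : (nbrs G univ i).powerset.filter (· ⊆ S) = (nbrs G univ i ∩ S).powerset := by
            ext A
            rw [mem_filter, mem_powerset, mem_powerset, subset_inter_iff]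
          simp only [one_mul]
          rw [← sum_filter, this, sum_const, nsmul_eq_mul, card_powerset]
          simp
        rw [e]
        split_ifs with hlt
        · rw [guess_eq, lt_div_iff₀ hq] at hlt
          have h2 : (2 : ℝ) ^ (nbrs G univ i ∩ S).card =
              Real.exp ((nbrs G univ i ∩ S).card * Real.log 2) := by
            rw [Real.exp_nat_mul, Real.exp_log two_pos]
          rw [h2, ← Real.exp_add]
          refine Real.one_le_exp ?_
          have h3 := Real.log_two_gt_d9
          have h4 : 3 * M i * q * Real.log 2 ≤ (nbrs G univ i ∩ S).card * Real.log 2 :=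
            mul_le_mul_of_nonneg_right hlt.le (by linarith)
          have h5 : 0 ≤ q * M i := mul_nonneg hq.le hM0
          nlinarith
        · positivity
    _ = Real.exp (-(2 * (q * M i))) * (1 + q) ^ (nbrs G univ i).card := by
        rw [dexp_const_mul, dexp_sum, ← sum_pow_card_powerset]
        congr 1
        refine sum_congr rfl fun A _ => ?_
        rw [dexp_superset hp q A (fun _ => 1), bexp_const, mul_one]
    _ ≤ Real.exp (-(2 * (q * M i))) * Real.exp (q * M i) := by
        refine mul_le_mul_of_nonneg_left ((one_add_pow_le_exp hq.le _).trans ?_)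
          (Real.exp_pos _).le
        refine Real.exp_le_exp.2 (mul_le_mul_of_nonneg_left ?_ hq.le)
        rw [card_nbrs_univ]
        exact hM i
    _ = _ := by
        rw [← Real.exp_add]
        congr 1
        ring

open Classical in
/-- A Chernoff bound for the weighted sampled degree. -/
theorem prob_sum_ipw_gt_le (hp : ∀ i, 0 < p i) (hp1 : ∀ i, p i ≤ 1) {θ : ℝ} (hθ : 0 ≤ θ)
    (hpθ : ∀ i, p i = 1 ∨ θ ≤ p i) (hM : ∀ i, (G.degree i : ℝ) ≤ M i) (i : V) :
    bexp univ p (fun U => if 3 * M i < ∑ j ∈ nbrs G univ i, ipw p U j then 1 else 0) ≤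
      Real.exp (-(θ * M i)) := by
  have hmgf := bexp_exp_sum_ipw_le (T := univ) (s := nbrs G univ i) (p := p) (r := p)
    (b := fun _ => θ) (v := fun _ => θ) (subset_univ _) hp (fun i => (hp i).le) hp1
    (fun _ _ => hθ) (fun j _ => (hpθ j).imp_right fun h => by
      have hpj := hp j
      have h1 : θ / p j ≤ 1 := (div_le_one hpj).2 h
      rw [abs_of_nonneg hθ]
      refine ⟨h1, ?_⟩
      calc p j * (θ / p j) ^ 2 = θ * (θ / p j) := by field_simp
        _ ≤ θ * 1 := mul_le_mul_of_nonneg_left h1 hθ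
        _ = θ := mul_one θ)
  calc _ ≤ bexp univ p (fun U => Real.exp (-(3 * M i * θ)) *
        Real.exp (∑ j ∈ nbrs G univ i, θ * ipw p U j)) := by
        refine bexp_mono (fun j _ => (hp j).le) (fun j _ => hp1 j) fun U _ => ?_
        split_ifs with hlt
        · rw [← Real.exp_add, ← mul_sum]
          exact Real.one_le_exp (by nlinarith)
        · positivity
    _ ≤ Real.exp (-(3 * M i * θ)) * Real.exp (2 * (M i * θ)) := by
        rw [bexp_const_mul]
        refine mul_le_mul_of_nonneg_left (hmgf.trans (Real.exp_le_exp.2 ?_)) (Real.exp_pos _).le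
        have e : ∑ j ∈ nbrs G univ i, θ * (p j / p j) = G.degree i * θ := by
          rw [← card_nbrs_univ, ← nsmul_eq_mul, ← sum_const]
          exact sum_congr rfl fun j _ => by rw [div_self (hp j).ne', mul_one]
        rw [e, sum_const, nsmul_eq_mul, card_nbrs_univ]
        nlinarith [mul_le_mul_of_nonneg_right (hM i) hθ]
    _ = _ := by
        rw [← Real.exp_add]
        congr 1
        ring

/-- The failure probability of the comparison of the two programs. The three terms bound the
probability that some guess is atypically large, that some sampled degree is atypically large, and
that the empirical dual value deviates for some side `A ⊆ S` of the partition. -/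
theorem doubleSampleProb_ge {D lam τ θ : ℝ} (hD : 0 < D) (hp : ∀ i, 0 < p i)
    (hp1 : ∀ i, p i ≤ 1) (hq : 0 < q) (hqp : ∀ i, q ≤ p i)
    (hM : ∀ i, (G.degree i : ℝ) ≤ M i) (hlam : 0 ≤ lam) (hτ : 0 ≤ τ) (hτ1 : 32 * τ ≤ 1)
    (hpM : ∀ i, p i = 1 ∨ lam * M i ≤ τ * p i) (hθ : 0 ≤ θ) (hpθ : ∀ i, p i = 1 ∨ θ ≤ p i)
    {s : V → ℝ} (hs : ∀ i, 0 < s i)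
    (hps : ∀ i j, p j = 1 ∨ (2 * s i ≤ p j ∧ 4 * s i ^ 2 * G.degree i ≤ p j)) (t : ℝ) :
    1 - (∑ i, Real.exp (-(q * M i)) + ∑ i, Real.exp (-(θ * M i)) +
        2 * Real.exp (24 * lam * ∑ i, 1 / s i + 1088 * lam * τ * ∑ i, M i - lam * t
          + 8 * q * Fintype.card V)) ≤
      doubleSampleProb p (fun _ => q) (fun S S' =>
        D ^ 2 * maxLP G S' (fun i j => 1 / (p i * p j * D ^ 2)) (fun v => q / p v) S - 2 * t ≤
          maxLPFull G (fun _ => q) S) := by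
  classical
  have hdual := fun A : Finset V => exists_dualObjective_le G univ (w := fun _ _ => (1 : ℝ))
    (fun _ => q) A (fun _ _ => rfl)
  choose z hz hzle using hdual
  -- The bad event for a fixed side `A` of the partition.
  let Q : Finset V → Finset V → ℝ := fun A U =>
    if (∀ i, guess G q A i ≤ 3 * M i) ∧ (∀ i, ∑ j ∈ nbrs G univ i, ipw p U j ≤ 3 * M i) ∧
      ∑ i, dualTerm G q A (z A) i + 2 * t < ∑ i, dualTerm G q A (z A) i * ipw p U i +
        ∑ i, ipw p U i * |nbrError G p (fun j => 1 - z A j) U i| then 1 else 0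
  set X := 24 * lam * ∑ i, 1 / s i + 1088 * lam * τ * ∑ i, M i - lam * t with hX
  have hQ : ∀ A, bexp univ (condProb p A) (Q A) ≤ 2 * Real.exp X * Real.exp 2 ^ A.card := by
    intro A
    have hr : 2 * Real.exp X * Real.exp 2 ^ A.card = 2 * Real.exp (24 * lam * ∑ i, 1 / s i +
        2 * A.card + 1088 * lam * τ * ∑ i, M i - lam * t) := by
      rw [← Real.exp_nat_mul, mul_assoc, ← Real.exp_add]
      congr 2
      rw [hX]
      ring
    by_cases hA : ∀ i, guess G q A i ≤ 3 * M i
    · have e := prob_deviation_le G hp hp1 A (c := fun j => 1 - z A j)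
        (fun i => by linarith [(abs_le.1 (hz A i)).2])
        (fun i => by linarith [(abs_le.1 (hz A i)).1]) hlam hτ hτ1 hM hpM hs hps
        (f := dualTerm G q A (z A))
        (fun i => (abs_dualTerm_le G hq A (hz A) i).trans (by linarith [hA i, hM i])) t
      rw [hr]
      refine le_trans (le_of_eq ?_) e
      exact bexp_congr fun U _ => by simp only [Q, hA, implies_true, true_and]
    · have : bexp univ (condProb p A) (Q A) = bexp univ (condProb p A) (fun _ => 0) :=
        bexp_congr fun U _ => if_neg fun h => hA h.1
      rw [this, bexp_const]
      positivity
  have hfail : 1 ≤ dexp p q (fun S S' => (if D ^ 2 * maxLP G S'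
        (fun i j => 1 / (p i * p j * D ^ 2)) (fun v => q / p v) S - 2 * t ≤
          maxLPFull G (fun _ => q) S then 1 else 0) +
      (∑ i, (if 3 * M i < guess G q S i then 1 else 0) +
      ((∑ i, if 3 * M i < ∑ j ∈ nbrs G univ i, ipw p S' j then 1 else 0) +
      ∑ A ∈ univ.powerset, Q A S' * if A ⊆ S then 1 else 0))) := by
    refine (dexp_const p q 1).symm.le.trans ?_
    refine dexp_mono hp hp1 hq.le hqp fun S S' hS => ?_
    have n1 : (0 : ℝ) ≤ ∑ i, (if 3 * M i < guess G q S i then 1 else 0) :=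
      sum_nonneg fun i _ => by split_ifs <;> simp
    have n2 : (0 : ℝ) ≤ ∑ i, if 3 * M i < ∑ j ∈ nbrs G univ i, ipw p S' j then 1 else 0 :=
      sum_nonneg fun i _ => by split_ifs <;> simp
    have hQ0 : ∀ A, 0 ≤ Q A S' * if A ⊆ S then 1 else 0 := fun A => by
      simp only [Q]
      split_ifs <;> simp
    have n3 : 0 ≤ ∑ A ∈ univ.powerset, Q A S' * if A ⊆ S then 1 else 0 :=
      sum_nonneg fun A _ => hQ0 A
    by_cases hE : D ^ 2 * maxLP G S' (fun i j => 1 / (p i * p j * D ^ 2)) (fun v => q / p v) S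
        - 2 * t ≤ maxLPFull G (fun _ => q) S
    · rw [if_pos hE]
      linarith
    rw [if_neg hE, zero_add]
    by_cases h1 : ∀ i, guess G q S i ≤ 3 * M i
    swap
    · push Not at h1
      obtain ⟨i, hi⟩ := h1
      have := single_le_sum (f := fun i => if 3 * M i < guess G q S i then (1 : ℝ) else 0)
        (fun i _ => by split_ifs <;> simp) (mem_univ i)
      simp only [if_pos hi] at this
      linarith
    by_cases h2 : ∀ i, ∑ j ∈ nbrs G univ i, ipw p S' j ≤ 3 * M i
    swap
    · push Not at h2
      obtain ⟨i, hi⟩ := h2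
      have := single_le_sum
        (f := fun i => if 3 * M i < ∑ j ∈ nbrs G univ i, ipw p S' j then (1 : ℝ) else 0)
        (fun i _ => by split_ifs <;> simp) (mem_univ i)
      simp only [if_pos hi] at this
      linarith
    obtain ⟨A, hA, hAeq⟩ := exists_mem_eq_sup' (s := S.powerset)
      ⟨∅, empty_mem_powerset S⟩ (fun A => lpValue G S' (fun i j => 1 / (p i * p j * D ^ 2))
        (fun v => q / p v) A)
    have hfull : lpValue G univ (fun _ _ => 1) (fun _ => q) A ≤ maxLPFull G (fun _ => q) S :=
      le_sup' (f := fun A => lpValue G univ (fun _ _ => (1 : ℝ)) (fun _ => q) A) hA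
    have hAS := mem_powerset.1 hA
    have hle := sampled_lpValue_le G hp (q := q) hD (hAS.trans hS) (hz A)
    have hzA := hzle A
    rw [dualObjective_univ] at hzA
    rw [maxLP, hAeq, not_le] at hE
    have hQA : Q A S' * (if A ⊆ S then 1 else 0) = 1 := by
      rw [if_pos hAS, mul_one]
      refine if_pos ⟨fun i => (guess_mono G hq hAS i).trans (h1 i), h2, ?_⟩
      linarith
    have := single_le_sum (f := fun A => Q A S' * if A ⊆ S then 1 else 0)
      (fun A _ => hQ0 A) (mem_powerset.2 (subset_univ A))
    simp only [hQA] at this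
    linarith
  rw [dexp_add, dexp_add, dexp_add, dexp_sum, dexp_sum, dexp_sum, ← doubleSampleProb_eq_dexp]
    at hfail
  have b1 : ∑ i, dexp p q (fun S _ => if 3 * M i < guess G q S i then 1 else 0) ≤
      ∑ i, Real.exp (-(q * M i)) :=
    sum_le_sum fun i _ => prob_guess_gt_le G hp hp1 hq hqp hM i
  have b2 : ∑ i, dexp p q (fun _ S' => if 3 * M i < ∑ j ∈ nbrs G univ i, ipw p S' j then 1 else 0)
      ≤ ∑ i, Real.exp (-(θ * M i)) :=
    sum_le_sum fun i _ => (dexp_sample p q _).trans_le (prob_sum_ipw_gt_le G hp hp1 hθ hpθ hM i)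
  have b3 : ∑ A ∈ univ.powerset, dexp p q (fun S S' => Q A S' * if A ⊆ S then 1 else 0) ≤
      2 * Real.exp (X + 8 * q * Fintype.card V) := by
    calc _ ≤ ∑ A ∈ (univ : Finset V).powerset, 2 * Real.exp X * (q * Real.exp 2) ^ A.card := by
          refine sum_le_sum fun A _ => ?_
          rw [dexp_superset hp, mul_pow]
          have := mul_le_mul_of_nonneg_left (hQ A) (pow_nonneg hq.le A.card)
          linarith
      _ = 2 * Real.exp X * (1 + q * Real.exp 2) ^ Fintype.card V := by
          rw [← mul_sum, sum_pow_card_powerset, card_univ]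
      _ ≤ 2 * Real.exp X * Real.exp (8 * q * Fintype.card V) := by
          refine mul_le_mul_of_nonneg_left ((one_add_pow_le_exp (by positivity) _).trans
            (Real.exp_le_exp.2 ?_)) (by positivity)
          have he : Real.exp 2 ≤ 8 := by
            have h1 := Real.exp_one_lt_d9
            have h2 : Real.exp 2 = Real.exp 1 * Real.exp 1 := by
              rw [← Real.exp_add]; norm_num
            nlinarith [Real.exp_pos 1]
          rw [mul_comm 8 q]
          gcongr
      _ = _ := by rw [mul_assoc, ← Real.exp_add]
  linarith

end UnionBound

/-! ### The parameters of the sampling scheme -/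

section Parameters

variable {V : Type*} [Fintype V] [DecidableEq V] (G : SimpleGraph V) [DecidableRel G.Adj]

omit [DecidableEq V] in
theorem card_pos_of_avgDegree_pos (h : 0 < avgDegree G) : (0 : ℝ) < Fintype.card V := by
  rcases (Nat.cast_nonneg (α := ℝ) (Fintype.card V)).eq_or_lt with h0 | h0
  · rw [avgDegree, ← h0, div_zero] at h
    exact absurd h (lt_irrefl 0)
  · exact h0

omit [DecidableEq V] in
theorem sum_degree_eq (h : 0 < avgDegree G) :
    ∑ i, (G.degree i : ℝ) = Fintype.card V * avgDegree G := by
  rw [avgDegree, mul_div_cancel₀ _ (card_pos_of_avgDegree_pos G h).ne']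

omit [DecidableEq V] in
theorem avgDegree_le (h : 0 < avgDegree G) : avgDegree G ≤ Fintype.card V - 1 := by
  have hn := card_pos_of_avgDegree_pos G h
  have hle : ∑ i, (G.degree i : ℝ) ≤ ∑ _i : V, ((Fintype.card V : ℝ) - 1) := by
    refine sum_le_sum fun i _ => ?_
    have : (G.degree i : ℝ) + 1 ≤ Fintype.card V := by exact_mod_cast G.degree_lt_card_verts i
    linarith
  rw [sum_degree_eq G h, sum_const, nsmul_eq_mul, card_univ] at hle
  exact le_of_mul_le_mul_left hle hn

end Parameters

/-- The three failure probabilities, expressed in powers of `exp (-16 log n) = n ^ (-16)`. -/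
theorem failure_sum_le {n : ℕ} (hn : 2 ≤ n) {a b c L : ℝ} (hL : L = Real.log n)
    (ha : a ≤ n * Real.exp (-(16 * L))) (hb : b ≤ n * Real.exp (-(16 * L)))
    (hc : c ≤ Real.exp (-(16 * L))) : a + b + 2 * c ≤ 1 / (n : ℝ) ^ 2 := by
  have hn2 : (2 : ℝ) ≤ n := by exact_mod_cast hn
  have hn0 : (0 : ℝ) < n := by linarith
  have he : Real.exp (-(16 * L)) = 1 / (n : ℝ) ^ 16 := by
    have : (16 : ℝ) * L = (16 : ℕ) * L := by norm_num
    rw [Real.exp_neg, this, Real.exp_nat_mul, hL, Real.exp_log hn0, one_div]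
  rw [he] at ha hb hc
  have h4 : (4 : ℝ) ≤ (n : ℝ) ^ 13 :=
    calc (4 : ℝ) ≤ 2 ^ 13 := by norm_num
      _ ≤ _ := pow_le_pow_left₀ (by norm_num) hn2 13
  have h5 : 4 * (n * (1 / (n : ℝ) ^ 16)) ≤ 1 / (n : ℝ) ^ 2 := by
    have : 4 * (n * (1 / (n : ℝ) ^ 16)) = 4 / (n : ℝ) ^ 13 * (1 / (n : ℝ) ^ 2) := by
      field_simp
    rw [this]
    exact mul_le_of_le_one_left (by positivity) ((div_le_one (by positivity)).2 h4)
  have h6 : 1 / (n : ℝ) ^ 16 ≤ n * (1 / (n : ℝ) ^ 16) :=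
    le_mul_of_one_le_left (by positivity) (by linarith)
  linarith

end VertexSample

theorem theorem5p1 :
    ∃ C₀ : ℝ, 0 < C₀ ∧ ∀ C : ℝ, C₀ ≤ C →
      ∀ (V : Type*) [Fintype V] [DecidableEq V] (G : SimpleGraph V) [DecidableRel G.Adj]
        (ε : ℝ) (p : V → ℝ),
        0 < ε → ε < 1 →
        0 < VertexSample.avgDegree G →
        (∀ v, VertexSample.importanceScore G C ε v ≤ p v) →
        (∀ v, p v ≤ 2 * VertexSample.importanceScore G C ε v) →
        (∀ v, p v ≤ 1) →
        (∀ v, VertexSample.seedProb G ε ≤ p v) →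
        1 - 1 / (Fintype.card V : ℝ) ^ 2 ≤
          VertexSample.doubleSampleProb p (fun _ => VertexSample.seedProb G ε) (fun S S' =>
            VertexSample.avgDegree G ^ 2 *
                VertexSample.maxLPSampled G p (fun _ => VertexSample.seedProb G ε) S S'
              - ε * (Fintype.card V : ℝ) * VertexSample.avgDegree G
            ≤ VertexSample.maxLPFull G (fun _ => VertexSample.seedProb G ε) S) := by
  refine ⟨20000000, by norm_num, ?_⟩
  intro C hC V _ _ G _ ε p hε hε1 hD hh _ hp1 hqp
  have hn0 := VertexSample.card_pos_of_avgDegree_pos G hD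
  have hDn := VertexSample.avgDegree_le G hD
  have hsum := VertexSample.sum_degree_eq G hD
  have hn2 : 2 ≤ Fintype.card V := by
    have : (1 : ℝ) < Fintype.card V := by linarith
    exact_mod_cast this
  obtain ⟨L, hL⟩ : ∃ L, L = Real.log (Fintype.card V) := ⟨_, rfl⟩
  have hL2 : 1 / 2 ≤ L := by
    have h1 := Real.log_two_gt_d9
    have h2 : Real.log 2 ≤ L := by
      rw [hL]
      exact Real.log_le_log two_pos (by exact_mod_cast hn2)
    linarith
  have hL0 : 0 < L := by linarith
  have hC0 : 0 < C := by linarith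
  have hqdef : VertexSample.seedProb G ε = 16 * L / (ε ^ 2 * VertexSample.avgDegree G) := by
    rw [VertexSample.seedProb, hL]
  -- The minimum in the importance score splits the vertices into those with `p i = 1` and those
  -- with `p i` at least proportional to `max {d_i, ε Δ}`.
  have hpcase : ∀ i, p i = 1 ∨ max (G.degree i : ℝ) (ε * VertexSample.avgDegree G) *
      (C * L) ≤ p i * (VertexSample.avgDegree G ^ 2 * ε ^ 4) := by
    intro i
    have h1 := hh i
    rw [VertexSample.importanceScore, VertexSample.alphaParam, ← hL] at h1
    rcases min_le_iff.1 h1 with h2 | h2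
    · exact Or.inl (le_antisymm (hp1 i) h2)
    · right
      rw [← mul_div_assoc, div_div_eq_mul_div] at h2
      exact (div_le_iff₀ (by positivity)).1 h2
  set D := VertexSample.avgDegree G with hDdef
  set q := VertexSample.seedProb G ε with hq
  set n := Fintype.card V with hn
  have hq0 : 0 < q := by rw [hqdef]; positivity
  have hp : ∀ i, 0 < p i := fun i => hq0.trans_le (hqp i)
  have hCL : 10000000 ≤ C * L := by nlinarith
  have hε2 : ε ^ 2 ≤ 1 := pow_le_one₀ hε.le hε1.le
  have hM : ∀ i, (G.degree i : ℝ) ≤ max (G.degree i : ℝ) (ε * D) := fun i => le_max_left _ _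
  have hM' : ∀ i, ε * D ≤ max (G.degree i : ℝ) (ε * D) := fun i => le_max_right _ _
  have hMsum : ∑ i, max (G.degree i : ℝ) (ε * D) ≤ 2 * (n * D) := by
    calc _ ≤ ∑ i, ((G.degree i : ℝ) + D) := by
          refine sum_le_sum fun i _ => max_le (by linarith) ?_
          have := Nat.cast_nonneg (α := ℝ) (G.degree i)
          nlinarith
      _ = 2 * (n * D) := by
          rw [sum_add_distrib, hsum, sum_const, nsmul_eq_mul, card_univ]
          ring
  have hpM : ∀ i, p i = 1 ∨ C * L / (20000 * ε ^ 3 * D ^ 2) * max (G.degree i : ℝ) (ε * D) ≤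
      ε / 20000 * p i := fun i => (hpcase i).imp_right fun h => by
    rw [div_mul_eq_mul_div, div_le_iff₀ (by positivity)]
    calc _ = max (G.degree i : ℝ) (ε * D) * (C * L) := mul_comm _ _
      _ ≤ _ := h
      _ = _ := by ring
  -- Every vertex has `max {d_i, ε Δ} ≥ ε Δ`, which gives a uniform lower bound on `p i`.
  have hpθ : ∀ i, p i = 1 ∨ C * L / (ε ^ 3 * D) ≤ p i := fun i => (hpcase i).imp_right fun h => by
    rw [div_le_iff₀ (by positivity)]
    refine le_of_mul_le_mul_left ?_ (mul_pos hε hD)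
    calc _ ≤ max (G.degree i : ℝ) (ε * D) * (C * L) :=
          mul_le_mul_of_nonneg_right (hM' i) (by linarith)
      _ ≤ _ := h
      _ = _ := by ring
  have hdD : ∀ i, 0 < (G.degree i : ℝ) + D := fun i =>
    add_pos_of_nonneg_of_pos (Nat.cast_nonneg _) hD
  have hs : ∀ i, 0 < 400 / (ε * (G.degree i + D)) := fun i =>
    div_pos (by norm_num) (mul_pos hε (hdD i))
  have hps : ∀ i j, p j = 1 ∨ (2 * (400 / (ε * (G.degree i + D))) ≤ p j ∧
      4 * (400 / (ε * (G.degree i + D))) ^ 2 * G.degree i ≤ p j) := by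
    intro i j
    refine (hpθ j).imp_right fun h => ⟨le_trans ?_ h, le_trans ?_ h⟩
    · have hd := hdD i
      rw [← mul_div_assoc, div_le_div_iff₀ (by positivity) (by positivity)]
      have h1 : 800 * ε ^ 2 ≤ C * L := by linarith
      have h2 : D ≤ G.degree i + D := le_add_of_nonneg_left (Nat.cast_nonneg _)
      calc 2 * 400 * (ε ^ 3 * D) = ε * (800 * ε ^ 2 * D) := by ring
        _ ≤ ε * (C * L * (G.degree i + D)) :=
          mul_le_mul_of_nonneg_left (mul_le_mul h1 h2 hD.le (by linarith)) hε.le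
        _ = _ := by ring
    · have hd := hdD i
      have hd0 := Nat.cast_nonneg (α := ℝ) (G.degree i)
      have e : 4 * (400 / (ε * (G.degree i + D))) ^ 2 * (G.degree i : ℝ) =
          640000 * G.degree i / (ε ^ 2 * (G.degree i + D) ^ 2) := by
        field_simp
        ring
      rw [e, div_le_div_iff₀ (by positivity) (by positivity)]
      have h1 : 640000 * ε ≤ C * L := by linarith
      have h2 : (G.degree i : ℝ) * D ≤ (G.degree i + D) ^ 2 := by nlinarith
      calc 640000 * (G.degree i : ℝ) * (ε ^ 3 * D) =
            ε ^ 2 * (640000 * ε * (G.degree i * D)) := by ring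
        _ ≤ ε ^ 2 * (C * L * (G.degree i + D) ^ 2) :=
          mul_le_mul_of_nonneg_left (mul_le_mul h1 h2 (by positivity) (by linarith))
            (sq_nonneg ε)
        _ = _ := by ring
  -- With `B = Δ² α_ε`, which bounds `M i / p i` unless `p i = 1`, the parameter is
  -- `lam = ε / (20000 B)`, the order that optimizes the exponent for the deviation `ε n Δ / 2`.
  -- The mean sampling error at `i` is at most `6 / s i = 6 ε (d_i + Δ) / 400`, up to the bias from `A`.
  have hmain := VertexSample.doubleSampleProb_ge G hD hp hp1 hq0 hqp hM
    (lam := C * L / (20000 * ε ^ 3 * D ^ 2)) (τ := ε / 20000) (θ := C * L / (ε ^ 3 * D))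
    (by positivity) (by positivity) (by linarith) hpM (by positivity) hpθ hs hps
    (ε * n * D / 2)
  have h2t : 2 * (ε * n * D / 2) = ε * n * D := by ring
  rw [h2t] at hmain
  refine le_trans (sub_le_sub_left (VertexSample.failure_sum_le hn2 hL ?_ ?_ ?_) 1) hmain
  · have h1 : ∀ i ∈ (univ : Finset V), Real.exp (-(q * max (G.degree i : ℝ) (ε * D))) ≤
        Real.exp (-(16 * L)) := fun i _ => by
      refine Real.exp_le_exp.2 (neg_le_neg ?_)
      refine le_trans ?_ (mul_le_mul_of_nonneg_left (hM' i) hq0.le)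
      have e : q * (ε * D) = 16 * L / ε := by rw [hqdef]; field_simp
      rw [e, le_div_iff₀ hε]
      nlinarith
    exact (sum_le_card_nsmul _ _ _ h1).trans_eq (by rw [nsmul_eq_mul, card_univ])
  · have h1 : ∀ i ∈ (univ : Finset V),
        Real.exp (-(C * L / (ε ^ 3 * D) * max (G.degree i : ℝ) (ε * D))) ≤
        Real.exp (-(16 * L)) := fun i _ => by
      refine Real.exp_le_exp.2 (neg_le_neg ?_)
      refine le_trans ?_ (mul_le_mul_of_nonneg_left (hM' i) (by positivity))
      have e : C * L / (ε ^ 3 * D) * (ε * D) = C * L / ε ^ 2 := by field_simp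
      rw [e, le_div_iff₀ (by positivity)]
      nlinarith
    exact (sum_le_card_nsmul _ _ _ h1).trans_eq (by rw [nsmul_eq_mul, card_univ])
  · refine Real.exp_le_exp.2 ?_
    set lam := C * L / (20000 * ε ^ 3 * D ^ 2) with hlam
    have hlam0 : 0 < lam := by positivity
    -- The exponent of the concentration bound is `C` times a constant multiple of `q n`, the order
    -- of the exponent lost in the union bound.
    have hkey : lam * (ε * n * D) = C / 320000 * (q * n) := by
      rw [hlam, hqdef]
      field_simp
      ring
    have hs_sum : ∑ i, 1 / (400 / (ε * ((G.degree i : ℝ) + D))) = ε * n * D / 200 := by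
      have : ∀ i, 1 / (400 / (ε * ((G.degree i : ℝ) + D))) = ε / 400 * (G.degree i + D) := by
        intro i
        rw [one_div_div]
        ring
      rw [sum_congr rfl fun i _ => this i, ← mul_sum, sum_add_distrib, hsum, sum_const,
        nsmul_eq_mul, card_univ]
      ring
    have hqn : 16 * L ≤ q * n := by
      rw [hqdef, div_mul_eq_mul_div, le_div_iff₀ (by positivity)]
      refine mul_le_mul_of_nonneg_left ?_ (by positivity)
      calc ε ^ 2 * D ≤ 1 * D := mul_le_mul_of_nonneg_right hε2 hD.le
        _ ≤ n := by linarith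
    have e1 : 1088 * lam * (ε / 20000) * ∑ i, max (G.degree i : ℝ) (ε * D) ≤
        1088 * lam * (ε / 20000) * (2 * (n * D)) :=
      mul_le_mul_of_nonneg_left hMsum (by positivity)
    have e2 : 20000000 / 320000 * (q * n) ≤ C / 320000 * (q * n) :=
      mul_le_mul_of_nonneg_right (by linarith) (by positivity)
    rw [hs_sum]
    have e3 : 1088 * lam * (ε / 20000) * (2 * (n * D)) = 2176 / 20000 * (lam * (ε * n * D)) := by
      ring
    have e4 : 24 * lam * (ε * n * D / 200) = 24 / 200 * (lam * (ε * n * D)) := by ring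
    have e5 : lam * (ε * n * D / 2) = 1 / 2 * (lam * (ε * n * D)) := by ring
    rw [e4, e5]
    linarith
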